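/- Let $T:\mathbb{R}\to\mathbb{R}$ be the tent map, i.e. the function of period $1$ with $T(x)=x$ on $[0,\tfrac12]$ and $T(x)=1-x$ on $[\tfrac12,1]$, let $T_{a,b}(x)=\sum_{n=0}^{\infty}a^nT(b^nx)$, and let $\Gamma_{T_{a,b}}=\{(x,T_{a,b}(x)):x\in[0,1]\}\subset\mathbb{R}^2$, where $\mathbb{R}^2$ carries the Euclidean metric. For a bounded set $F\subset\mathbb{R}^2$ let $N_r(F)$ be the least number of closed balls of radius $r$ that cover $F$, and let $B(x,R)$ be the closed ball of centre $x$ and radius $R$. Let $\dim_{\mathrm H}$ denote Hausdorff dimension, and put $$\overline{\dim}_{\mathrm B}F=\limsup_{r\to0^+}\Bigl(-\frac{\log N_r(F)}{\log r}\Bigr),$$ $$\dim_{\mathrm A}F=\inf\Bigl\{s\ge0:\ \exists C>0\ \forall R>0\ \forall r\in(0,R)\ \forall x\in F,\ N_r(B(x,R)\cap F)\le C\bigl(\tfrac Rr\bigr)^s\Bigr\}.$$ Fix a compact reference set $X\subset\mathbb{R}^2$ with non-empty interior (for example the closed unit ball or a closed square). A non-empty compact set $E\subset\mathbb{R}^2$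 is a weak tangent of a compact set $F\subset\mathbb{R}^2$ (with respect to $X$) if there are similarity maps $T_k:\mathbb{R}^2\to\mathbb{R}^2$ such that $T_k(F)\cap X\to E$ in the Hausdorff metric as $k\to\infty$ (in particular $T_k(F)\cap X\neq\emptyset$ for all large $k$). **Lemma.** Let $a<1$ be real and let $b>2$ be an integer such that $ab>1$ and $ab$ is a root of a Littlewood polynomial, i.e. $\sum_{n=0}^{k-1}\epsilon_n(ab)^n=0$ for some $k\ge1$ and some $\epsilon_0,\dots,\epsilon_{k-1}\in\{-1,1\}$. Then, for every such reference set $X$, there is a weak tangent $E$ of $\Gamma_{T_{a,b}}$ with $$\dim_{\mathrm H}E=\dim_{\mathrm A}\Gamma_{T_{a,b}}\ \ge\ \overline{\dim}_{\mathrm B}\Gamma_{T_{a,b}}.$$ The last inequality can be strict: for $ab=\frac{1+\sqrt5}{2}$ and $b=8$, which satisfy the assumptions, $\dim_{\mathrm A}\Gamma_{T_{a,b}}>\overline{\dim}_{\mathrm B}\Gamma_{T_{a,b}}$. -/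

import Mathlib

open Filter Topology Set
open scoped NNReal ENNReal

/-- The tent map: the function of period `1` that equals `x` on `[0, 1/2]` and `1 - x` on
`[1/2, 1]`. -/
noncomputable def tent (x : ℝ) : ℝ :=
  if Int.fract x ≤ 1 / 2 then Int.fract x else 1 - Int.fract x

/-- The Takagi function `T_{a,b}(x) = ∑_{n ≥ 0} a ^ n * T (b ^ n * x)`, `T` being the tent map.
The series converges absolutely when `|a| < 1`. -/
noncomputable def takagi (a b : ℝ) (x : ℝ) : ℝ :=
  ∑' n : ℕ, a ^ n * tent (b ^ n * x)

/-- The graph of `f` over `[0, 1]`, as a subset of the Euclidean plane. -/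
def graphOnUnit (f : ℝ → ℝ) : Set (EuclideanSpace ℝ (Fin 2)) :=
  {p | p 0 ∈ Icc (0 : ℝ) 1 ∧ p 1 = f (p 0)}

/-- `x` is a root of a Littlewood polynomial, that is, of a polynomial of some degree
`k - 1 ≥ 0` all of whose `k` coefficients are `1` or `-1`. -/
def IsLittlewoodRoot (x : ℝ) : Prop :=
  ∃ (k : ℕ) (ε : ℕ → ℝ), 1 ≤ k ∧ (∀ n < k, ε n = 1 ∨ ε n = -1) ∧
    ∑ n ∈ Finset.range k, ε n * x ^ n = 0

/-- The parameters considered: `a < 1`, `b` is an integer greater than `2`, and the product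
`a * b > 1` is a root of a Littlewood polynomial. -/
def IsLittlewoodTakagiParam (a : ℝ) (b : ℕ) : Prop :=
  a < 1 ∧ 2 < b ∧ 1 < a * b ∧ IsLittlewoodRoot (a * b)

section Dimensions

variable {M : Type*} [PseudoEMetricSpace M]

/-- The upper box dimension `limsup_{r → 0+} - log N_r(F) / log r`, where `N_r(F)` is the least
number of closed balls of radius `r` that cover `F`. -/
noncomputable def upperBoxDim (F : Set M) : EReal :=
  limsup (fun r : ℝ≥0 =>
    ENNReal.log ((Metric.externalCoveringNumber r F : ℕ∞) : ℝ≥0∞) /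
      ((-Real.log (r : ℝ) : ℝ) : EReal)) (𝓝[>] (0 : ℝ≥0))

/-- The Assouad dimension: the infimum of all `s ≥ 0` for which there is `C > 0` such that
`N_r(B(x, R) ∩ F) ≤ C * (R / r) ^ s` for all `0 < r < R` and all `x ∈ F`, where `B(x, R)` is the
closed ball and `N_r` is the least number of closed balls of radius `r` that cover. -/
noncomputable def assouadDim (F : Set M) : ℝ≥0∞ :=
  ⨅ (s : ℝ≥0) (_ : ∃ C : ℝ≥0, 0 < C ∧ ∀ R r : ℝ≥0, 0 < r → r < R → ∀ x ∈ F,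
      ((Metric.externalCoveringNumber r (Metric.closedEBall x (R : ℝ≥0∞) ∩ F) : ℕ∞) : ℝ≥0∞) ≤
        ((C * (R / r) ^ (s : ℝ) : ℝ≥0) : ℝ≥0∞)), (s : ℝ≥0∞)

/-- With respect to the reference set `X`, the non-empty compact set `E` is a weak tangent of the
compact set `F`: there are similarities `T k` of the space such that `T k (F) ∩ X` converges to
`E` in the Hausdorff metric as `k → ∞`. The extended Hausdorff distance between a non-empty set
and the empty set is infinite, so `T k (F) ∩ X` is non-empty for all large `k`. -/
def IsWeakTangent (X E F : Set M) : Prop :=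
  IsCompact E ∧ E.Nonempty ∧ IsCompact F ∧
    ∃ T : ℕ → (M ≃ᵈ M),
      Tendsto (fun k => Metric.hausdorffEDist E ((T k '' F) ∩ X)) atTop (𝓝 0)

end Dimensions

/-! The tangent comes from a general fact about non-empty compact sets `F`. Let β be the Assouad
dimension and `p n` the largest number of balls of radius R/2^n needed for a piece of `F` in a ball
of radius R. Iterating covers gives p n ≥ 2^(nβ). Hence the normalised counts p n / 2^(nβ) stay
above 1 and cannot keep halving, so for every k some ball attaining `p n` is homogeneous: a sub-ball
of relative radius ρ ≥ 2^(-k) carries at most 2(2ρ)^β of its count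
(`exists_closedEBall_homogeneous`). Blowing these balls up into `X` and passing to a Hausdorff limit
gives a tangent whose covers all have β-sum bounded below (`le_dimH_of_tendsto_hausdorffEDist`). The
bound dim_H E ≤ β holds because Assouad bounds are scale invariant.

For the strict inequality put g = (1+√5)/2 and a = g/8. The relation g² = g + 1 makes the slopes 1,
g, -g² of the first three terms of the series cancel on eight intervals of length 1/512, where the
function is a vertically translated affine copy of itself, at one common height. Iterating gives 8^j
aligned copies. At fine scales each copy is far taller than wide, so locally the graph looks like an
interval times a set of dimension log 8 / log 512 = 1/3, and the Assouad dimension is at least 4/3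
(`four_thirds_le_assouadDim_takagi`). Hölder continuity with exponent 3/4 bounds the upper box
dimension by 5/4 (`upperBoxDim_takagi_goldenRatio_le`). -/

/-! ### Covering numbers. -/

open Metric in
theorem exists_isCover_encard_eq {M : Type*} [PseudoEMetricSpace M] (r : ℝ≥0) (A : Set M) :
    ∃ C : Set M, IsCover r A C ∧ C.encard = externalCoveringNumber r A := by
  have : Nonempty {C : Set M // IsCover r A C} := ⟨⟨A, by simp⟩⟩
  obtain ⟨C, hC⟩ := ENat.exists_eq_iInf (fun C : {C : Set M // IsCover r A C} => (C : Set M).encard)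
  exact ⟨C, C.2, by rw [hC, externalCoveringNumber, iInf_subtype]⟩

open Metric in
theorem externalCoveringNumber_le_sum {M ι : Type*} [PseudoEMetricSpace M] (r : ℝ≥0) {A : Set M}
    (I : Finset ι) (S : ι → Set M) (h : A ⊆ ⋃ i ∈ I, S i) :
    externalCoveringNumber r A ≤ ∑ i ∈ I, externalCoveringNumber r (S i) := by
  choose C hC hcard using fun i => exists_isCover_encard_eq r (S i)
  have hcov : IsCover r A (⋃ i ∈ I, C i) := by
    intro x hx
    obtain ⟨i, hi, hxi⟩ := mem_iUnion₂.1 (h hx)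
    obtain ⟨y, hy, hxy⟩ := hC i hxi
    exact ⟨y, mem_iUnion₂.2 ⟨i, hi, hy⟩, hxy⟩
  refine hcov.externalCoveringNumber_le_encard.trans ?_
  simp_rw [← hcard]
  clear hcov h
  classical
  induction I using Finset.induction_on with
  | empty => simp
  | insert i I hi ih =>
    rw [Finset.sum_insert hi, Finset.set_biUnion_insert]
    exact (encard_union_le _ _).trans (by gcongr)

open Metric in
theorem externalCoveringNumber_image_le {M M' : Type*} [PseudoEMetricSpace M]
    [PseudoEMetricSpace M'] {K : ℝ≥0} {f : M → M'} (hf : LipschitzWith K f) (r : ℝ≥0) (A : Set M) :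
    externalCoveringNumber (K * r) (f '' A) ≤ externalCoveringNumber r A := by
  obtain ⟨C, hC, hcard⟩ := exists_isCover_encard_eq r A
  rw [← hcard]
  exact (hC.image_lipschitz hf).externalCoveringNumber_le_encard.trans (encard_image_le _ _)

open Metric in
theorem externalCoveringNumber_le_mul {M : Type*} [PseudoEMetricSpace M] {r ρ : ℝ≥0} {A : Set M}
    {p q : ℕ} (hp : externalCoveringNumber ρ A ≤ p)
    (hq : ∀ y, externalCoveringNumber r (closedEBall y ρ ∩ A) ≤ q) :
    externalCoveringNumber r A ≤ (p * q : ℕ) := by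
  obtain ⟨C, hC, hcard⟩ := exists_isCover_encard_eq ρ A
  rw [← hcard] at hp
  have hfin : C.Finite := finite_of_encard_le_coe hp
  have hsub : A ⊆ ⋃ y ∈ hfin.toFinset, (closedEBall y ρ ∩ A) := by
    intro x hx
    obtain ⟨y, hy, hxy⟩ := hC hx
    exact mem_iUnion₂.2 ⟨y, by simpa using hy, hxy, hx⟩
  refine (externalCoveringNumber_le_sum r _ _ hsub).trans ?_
  refine (Finset.sum_le_sum fun y _ => hq y).trans ?_
  rw [hfin.encard_eq_coe_toFinset_card] at hp
  rw [Finset.sum_const, nsmul_eq_mul]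
  push_cast
  gcongr

open Metric in
theorem externalCoveringNumber_closedEBall_bdd {V : Type*} [NormedAddCommGroup V] [NormedSpace ℝ V]
    [ProperSpace V] {ε : ℝ≥0} (hε : ε ≠ 0) :
    ∃ K : ℕ, ∀ (x : V) (R : ℝ≥0), 0 < R →
      externalCoveringNumber (R * ε) (closedEBall x R) ≤ K := by
  obtain ⟨N, -, hfin, hN⟩ := exists_finite_isCover_of_isCompact (X := V) hε
    (isCompact_closedBall (0 : V) 1)
  refine ⟨hfin.toFinset.card, fun x R hR => ?_⟩
  have hf : LipschitzWith R (fun y : V => x + (R : ℝ) • y) := by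
    refine LipschitzWith.of_dist_le_mul fun y z => ?_
    rw [dist_add_left, dist_smul₀]
    simp
  have himg : closedEBall x R ⊆ (fun y : V => x + (R : ℝ) • y) '' closedBall 0 1 := by
    intro y hy
    have hR' : (0 : ℝ) < R := hR
    refine ⟨(R : ℝ)⁻¹ • (y - x), ?_, by simp [smul_smul, hR'.ne']⟩
    have : dist y x ≤ R := by
      rw [mem_closedEBall, edist_dist] at hy
      simpa using (ENNReal.ofReal_le_iff_le_toReal (by simp)).1 hy
    rw [mem_closedBall_zero_iff, norm_smul, norm_inv, Real.norm_of_nonneg hR'.le, ← dist_eq_norm]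
    rw [inv_mul_le_one₀ hR']
    exact this
  refine (externalCoveringNumber_mono_set himg).trans <|
    (externalCoveringNumber_image_le hf ε _).trans ?_
  refine hN.externalCoveringNumber_le_encard.trans ?_
  rw [hfin.encard_eq_coe_toFinset_card]

/-! ### Maximal counts and the Assouad dimension. -/

open Metric in
/-- `p n` is the largest number of balls of radius `R / 2 ^ n` needed to cover a piece of `F` lying
in a ball of radius `R`, over all scales `R` and all centres. -/
def IsMaxCount {V : Type*} [PseudoEMetricSpace V] (F : Set V) (p : ℕ → ℕ) : Prop :=
  ∀ n, (∀ (x : V) (R : ℝ≥0), 0 < R →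
      externalCoveringNumber (R / 2 ^ n) (closedEBall x R ∩ F) ≤ p n) ∧
    ∃ (x : V) (R : ℝ≥0), 0 < R ∧
      externalCoveringNumber (R / 2 ^ n) (closedEBall x R ∩ F) = p n

open Metric in
theorem exists_isMaxCount {V : Type*} [NormedAddCommGroup V] [NormedSpace ℝ V]
    [ProperSpace V] (F : Set V) : ∃ p, IsMaxCount F p := by
  refine Classical.axiomOfChoice (r := fun n q => (∀ (x : V) (R : ℝ≥0), 0 < R →
      externalCoveringNumber (R / 2 ^ n) (closedEBall x R ∩ F) ≤ (q : ℕ)) ∧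
    ∃ (x : V) (R : ℝ≥0), 0 < R ∧
      externalCoveringNumber (R / 2 ^ n) (closedEBall x R ∩ F) = q) fun n => ?_
  obtain ⟨K, hK⟩ := externalCoveringNumber_closedEBall_bdd (V := V) (ε := (2 ^ n)⁻¹) (by positivity)
  have hK' : ∀ (x : V) (R : ℝ≥0), 0 < R →
      externalCoveringNumber (R / 2 ^ n) (closedEBall x R ∩ F) ≤ K := fun x R hR =>
    (externalCoveringNumber_mono_set inter_subset_left).trans (by
      rw [div_eq_mul_inv]; exact hK x R hR)
  let S : Set ℕ := {v | ∃ (x : V) (R : ℝ≥0), 0 < R ∧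
      externalCoveringNumber (R / 2 ^ n) (closedEBall x R ∩ F) = v}
  have hlift : ∀ (x : V) (R : ℝ≥0), 0 < R → ∃ v : ℕ, v ≤ K ∧
      externalCoveringNumber (R / 2 ^ n) (closedEBall x R ∩ F) = v := by
    intro x R hR
    obtain ⟨v, hv⟩ := ENat.ne_top_iff_exists.1 ((hK' x R hR).trans_lt (ENat.natCast_lt_top K)).ne
    exact ⟨v, by have := hK' x R hR; rw [← hv] at this; exact_mod_cast this, hv.symm⟩
  have hbdd : BddAbove S := by
    refine ⟨K, ?_⟩
    rintro v ⟨x, R, hR, h⟩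
    have := hK' x R hR
    rw [h] at this
    exact_mod_cast this
  have hne : S.Nonempty := by
    obtain ⟨v, -, hv⟩ := hlift 0 1 one_pos
    exact ⟨v, 0, 1, one_pos, hv⟩
  refine ⟨sSup S, fun x R hR => ?_, Nat.sSup_mem hne hbdd⟩
  obtain ⟨v, -, hv⟩ := hlift x R hR
  rw [hv]
  exact_mod_cast le_csSup hbdd ⟨x, R, hR, hv⟩

namespace IsMaxCount

open Metric

theorem one_le {V : Type*} [PseudoEMetricSpace V] {F : Set V} {p : ℕ → ℕ} (hp : IsMaxCount F p)
    (hF : F.Nonempty) (n : ℕ) : 1 ≤ p n := by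
  obtain ⟨x, hx⟩ := hF
  have h := (hp n).1 x 1 one_pos
  have h0 : 0 < externalCoveringNumber (1 / 2 ^ n : ℝ≥0) (closedEBall x (1 : ℝ≥0) ∩ F) :=
    externalCoveringNumber_pos_iff.2 ⟨x, by simp, hx⟩
  exact_mod_cast h0.trans_le h

/-- Each ball of a cover is covered again at the next scale. The centres of an external cover need
not lie in `F`, which is why `IsMaxCount` admits every centre. -/
theorem le_pow {V : Type*} [PseudoEMetricSpace V] {F : Set V} {p : ℕ → ℕ} (hp : IsMaxCount F p)
    (n j : ℕ) (x : V) {R : ℝ≥0} (hR : 0 < R) :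
    externalCoveringNumber (R / (2 ^ n) ^ j) (closedEBall x R ∩ F) ≤ (p n ^ j : ℕ) := by
  induction j with
  | zero =>
    have h : IsCover R (closedEBall x R ∩ F) {x} := fun y hy => ⟨x, rfl, hy.1⟩
    simpa using h.externalCoveringNumber_le_encard
  | succ j ih =>
    rw [pow_succ (p n)]
    refine externalCoveringNumber_le_mul ih fun y => ?_
    rw [pow_succ, ← div_div]
    exact (externalCoveringNumber_mono_set (by gcongr; exact inter_subset_right)).trans
      ((hp n).1 y _ (by positivity))

theorem assouadDim_le {V : Type*} [PseudoEMetricSpace V] {F : Set V} {p : ℕ → ℕ}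
    (hp : IsMaxCount F p) {n : ℕ} (hn : n ≠ 0) {s : ℝ≥0}
    (h : (p n : ℝ≥0) ≤ (2 ^ n) ^ (s : ℝ)) : assouadDim F ≤ s := by
  -- The constant `(2 ^ n) ^ s` pays for rounding R/r up to the next power of 2^n.
  refine iInf₂_le_of_le s ⟨(2 ^ n) ^ (s : ℝ), by positivity, fun R r hr hrR x _ => ?_⟩ le_rfl
  have h1 : (1 : ℝ≥0) ≤ R / r := by rw [le_div_iff₀ hr]; simpa using hrR.le
  obtain ⟨j, hj, hj'⟩ := exists_nat_pow_near h1 (one_lt_pow₀ (one_lt_two : (1 : ℝ≥0) < 2) hn)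
  have hle : R / (2 ^ n) ^ (j + 1) ≤ r := by
    rw [div_lt_iff₀ hr] at hj'
    rw [div_le_iff₀ (by positivity), mul_comm]
    exact hj'.le
  have hcount := (externalCoveringNumber_anti hle).trans
    (hp.le_pow n (j + 1) x (R := R) (hr.trans hrR))
  have hreal : ((p n ^ (j + 1) : ℕ) : ℝ≥0) ≤ (2 ^ n) ^ (s : ℝ) * (R / r) ^ (s : ℝ) := by
    calc ((p n ^ (j + 1) : ℕ) : ℝ≥0) = (p n : ℝ≥0) ^ (j + 1) := by push_cast; rfl
      _ ≤ ((2 ^ n) ^ (s : ℝ)) ^ (j + 1) := by gcongr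
      _ = (2 ^ n) ^ (s : ℝ) * ((2 ^ n) ^ j) ^ (s : ℝ) := by
        rw [pow_succ', ← NNReal.rpow_mul_natCast, mul_comm (s : ℝ), NNReal.rpow_natCast_mul]
      _ ≤ _ := by gcongr
  calc ((externalCoveringNumber r (closedEBall x R ∩ F) : ℕ∞) : ℝ≥0∞)
      ≤ (((p n ^ (j + 1) : ℕ) : ℕ∞) : ℝ≥0∞) := by exact_mod_cast hcount
    _ = (((p n ^ (j + 1) : ℕ) : ℝ≥0) : ℝ≥0∞) := by push_cast; rfl
    _ ≤ _ := by exact_mod_cast hreal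

theorem assouadDim_ne_top {V : Type*} [PseudoEMetricSpace V] {F : Set V} {p : ℕ → ℕ}
    (hp : IsMaxCount F p) : assouadDim F ≠ ⊤ := by
  -- The exponent `p 1` is admissible because p 1 ≤ 2^(p 1).
  refine ne_top_of_le_ne_top ENNReal.coe_ne_top (hp.assouadDim_le one_ne_zero (s := p 1) ?_)
  simp only [pow_one, NNReal.coe_natCast, NNReal.rpow_natCast]
  exact_mod_cast Nat.lt_two_pow_self.le

/-- If some `p n` were smaller, its logarithm to base 2^n would be an admissible exponent below the
Assouad dimension. -/
theorem rpow_assouadDim_le {V : Type*} [PseudoEMetricSpace V] {F : Set V} {p : ℕ → ℕ}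
    (hp : IsMaxCount F p) (hF : F.Nonempty) (n : ℕ) :
    ((2 : ℝ) ^ n) ^ (assouadDim F).toReal ≤ p n := by
  rcases eq_or_ne n 0 with rfl | hn
  · simpa using hp.one_le hF 0
  have h1 : (1 : ℝ) ≤ p n := by exact_mod_cast hp.one_le hF n
  have h2 : (1 : ℝ) < 2 ^ n := one_lt_pow₀ one_lt_two hn
  by_contra! hlt
  have hs0 : 0 ≤ Real.logb (2 ^ n) (p n) := Real.logb_nonneg h2 h1
  lift Real.logb (2 ^ n) (p n) to ℝ≥0 using hs0 with s hs
  have hpow : ((2 : ℝ) ^ n) ^ (s : ℝ) = p n := by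
    rw [hs, Real.rpow_logb (by positivity) h2.ne' (by positivity)]
  have hle := hp.assouadDim_le hn (s := s) (by
    rw [← NNReal.coe_le_coe]
    push_cast
    rw [hpow])
  have hle' := ENNReal.toReal_mono ENNReal.coe_ne_top hle
  rw [ENNReal.coe_toReal] at hle'
  have := (Real.rpow_le_rpow_left_iff h2).2 hle'
  rw [hpow] at this
  exact absurd this hlt.not_ge

end IsMaxCount

/-! ### Homogeneous balls. -/

/-- A sequence bounded below by `1` cannot, at every late index, have dropped by a factor of two
within a window of fixed length. -/
theorem exists_forall_le_two_mul {u : ℕ → ℝ} (hu : ∀ n, 1 ≤ u n) (k : ℕ) :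
    ∃ n, k ≤ n ∧ ∀ m ≤ k, u (n - m) ≤ 2 * u n := by
  by_contra! hcon
  obtain ⟨M, hM⟩ : ∃ M, ∀ i < k, u i ≤ M :=
    ⟨∑ i ∈ Finset.range k, u i, fun i hi =>
      Finset.single_le_sum (f := u) (fun j _ => zero_le_one.trans (hu j)) (by simpa using hi)⟩
  -- Each block of `k` further indices costs another factor of two, which eventually forces `u`
  -- below 1.
  have hdrop : ∀ j n, j * k ≤ n → u n ≤ M / 2 ^ j := by
    intro j
    induction j with
    | zero =>
      intro n _
      induction n using Nat.strong_induction_on with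
      | _ n ih =>
        rcases lt_or_ge n k with hn | hn
        · simpa using hM n hn
        · obtain ⟨m, hm, hlt⟩ := hcon n hn
          have hm0 : m ≠ 0 := by
            rintro rfl
            have := hu n
            simp only [Nat.sub_zero] at hlt
            linarith
          have h1 := ih (n - m) (by omega) (by omega)
          have := hu n
          linarith
    | succ j ih =>
      intro n hn
      rw [add_mul, one_mul] at hn
      obtain ⟨m, hm, hlt⟩ := hcon n (by omega)
      have h1 := ih (n - m) (by omega)
      rw [pow_succ, ← div_div]
      linarith
  obtain ⟨j, hj⟩ := pow_unbounded_of_one_lt M one_lt_two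
  have h1 := hdrop j _ le_rfl
  have h2 := hu (j * k)
  have : M / 2 ^ j < 1 := by rw [div_lt_one (by positivity)]; exact hj
  linarith

-- Choose `n` so that p (n-m) / 2^((n-m)β) ≤ 2 p n / 2^(nβ) for all m ≤ k, and a ball attaining `p
-- n`. A sub-ball of radius at most R/2^m needs at most p (n-m) ≤ 2 · 2^(-mβ) · p n balls of radius
-- R/2^n. The 2 in front is the loss in the choice of `n`; the 2 multiplying ρ comes from rounding ρ
-- up to a power of 1/2.
open Metric in
theorem exists_closedEBall_homogeneous {V : Type*} [NormedAddCommGroup V] [NormedSpace ℝ V]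
    [ProperSpace V] {F : Set V} (hF : F.Nonempty) (k : ℕ) :
    ∃ (x : V) (R r : ℝ≥0) (q : ℕ), 0 < R ∧ 0 < q ∧
      externalCoveringNumber r (closedEBall x R ∩ F) = q ∧
      ∀ (y : V) (ρ : ℝ≥0), (1 / 2) ^ k ≤ ρ →
        ((externalCoveringNumber r (closedEBall y (ρ * R : ℝ≥0) ∩ (closedEBall x R ∩ F)) : ℕ∞) : ℝ≥0∞)
          ≤ ((2 * (2 * ρ) ^ (assouadDim F).toReal : ℝ≥0) : ℝ≥0∞) * q := by
  obtain ⟨p, hp⟩ := exists_isMaxCount F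
  set β := (assouadDim F).toReal with hβ
  have hβ0 : 0 ≤ β := ENNReal.toReal_nonneg
  obtain ⟨n, hkn, hn⟩ := exists_forall_le_two_mul (u := fun n => p n / ((2 : ℝ) ^ n) ^ β)
    (fun n => (one_le_div (by positivity)).2 (hp.rpow_assouadDim_le hF n)) k
  obtain ⟨x, R, hR, hx⟩ := (hp n).2
  refine ⟨x, R, R / 2 ^ n, p n, hR, hp.one_le hF n, hx, fun y ρ hρ => ?_⟩
  suffices h : ∃ v : ℕ, externalCoveringNumber (R / 2 ^ n)
      (closedEBall y (ρ * R : ℝ≥0) ∩ (closedEBall x R ∩ F)) ≤ v ∧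
      (v : ℝ≥0) ≤ 2 * (2 * ρ) ^ β * p n by
    obtain ⟨v, hv, hv'⟩ := h
    calc _ ≤ (((v : ℕ) : ℕ∞) : ℝ≥0∞) := by exact_mod_cast hv
      _ = ((v : ℝ≥0) : ℝ≥0∞) := by push_cast; rfl
      _ ≤ _ := by exact_mod_cast hv'
  rcases le_or_gt 1 ρ with h1 | h1
  · refine ⟨p n, hx ▸ externalCoveringNumber_mono_set inter_subset_right, ?_⟩
    have : (1 : ℝ≥0) ≤ (2 * ρ) ^ β := NNReal.one_le_rpow (by
      calc (1 : ℝ≥0) ≤ 2 * 1 := by norm_num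
        _ ≤ 2 * ρ := by gcongr) hβ0
    calc (p n : ℝ≥0) = 1 * 1 * p n := by ring
      _ ≤ 2 * (2 * ρ) ^ β * p n := by gcongr; norm_num
  · have hρ0 : 0 < ρ := lt_of_lt_of_le (by positivity) hρ
    obtain ⟨m, hm, hm'⟩ := exists_nat_pow_near_of_lt_one hρ0 h1.le
      (show (0 : ℝ≥0) < 1 / 2 by norm_num) (NNReal.half_lt_self one_ne_zero)
    have hmk : m ≤ k := (pow_le_pow_iff_right_of_lt_one₀ (by norm_num)
      (NNReal.half_lt_self one_ne_zero)).1 (hρ.trans hm')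
    refine ⟨p (n - m), ?_, ?_⟩
    · have h := (hp (n - m)).1 y (R / 2 ^ m) (by positivity)
      rw [div_div, ← pow_add, Nat.add_sub_cancel' (hmk.trans hkn)] at h
      refine (externalCoveringNumber_mono_set ?_).trans h
      refine inter_subset_inter (closedEBall_subset_closedEBall ?_) inter_subset_right
      rw [ENNReal.coe_le_coe, div_eq_inv_mul]
      gcongr
      simpa using hm'
    · have h := hn m hmk
      have hsplit : ((2 : ℝ) ^ n) ^ β = (2 ^ (n - m)) ^ β * (2 ^ m) ^ β := by
        rw [← Real.mul_rpow (by positivity) (by positivity), ← pow_add,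
          Nat.sub_add_cancel (hmk.trans hkn)]
      have hmρ : (1 : ℝ) ≤ 2 * ρ * 2 ^ m := by
        have : ((1 / 2 : ℝ≥0) : ℝ) ^ (m + 1) < ρ := by exact_mod_cast hm
        push_cast at this
        rw [one_div, inv_pow, pow_succ, inv_lt_iff_one_lt_mul₀ (by positivity)] at this
        linarith
      have hmρ' : (1 : ℝ) ≤ (2 * ρ) ^ β * (2 ^ m) ^ β := by
        rw [← Real.mul_rpow (by positivity) (by positivity)]
        exact Real.one_le_rpow hmρ hβ0
      rw [hsplit, ← mul_div_assoc, ← div_div, div_le_div_iff₀ (by positivity) (by positivity),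
        div_mul_cancel₀ _ (by positivity)] at h
      rw [← NNReal.coe_le_coe]
      push_cast
      have hpos : (0 : ℝ) < (2 ^ m) ^ β := by positivity
      have h3 : (p (n - m) : ℝ) * (2 ^ m) ^ β ≤ 2 * p n := h
      nlinarith [mul_le_mul_of_nonneg_left hmρ' (show (0 : ℝ) ≤ 2 * p n by positivity)]

/-! ### Hausdorff dimension from covers. -/

/-- This allows the sets of a cover to be enlarged to open balls of positive radius at an
arbitrarily small cost in the β-sum. -/
theorem NNReal.exists_gt_rpow_lt_add (d : ℝ≥0) {β ε : ℝ≥0} (hε : 0 < ε) :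
    ∃ ρ > d, ρ ^ (β : ℝ) < d ^ (β : ℝ) + ε := by
  have h := (NNReal.continuous_rpow_const β.2).tendsto d
  have h' := (h.mono_left (nhdsWithin_le_nhds (s := Ioi d))).eventually_lt_const
    (lt_add_of_pos_right (d ^ (β : ℝ)) hε)
  exact (eventually_mem_nhdsWithin.and h').exists

open Metric MeasureTheory in
/-- A mass distribution principle for Hausdorff limits: if efficient covers of the sets `S k` by
balls which are not too small have a large `β`-dimensional size, then the limit has Hausdorff
dimension at least `β`. -/
theorem le_dimH_of_tendsto_hausdorffEDist {M : Type*} [EMetricSpace M] {E : Set M} {S : ℕ → Set M}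
    (hE : IsCompact E) (hE' : E.Nonempty)
    (hS : Tendsto (fun k => hausdorffEDist E (S k)) atTop (𝓝 0))
    {β : ℝ≥0} {c : ℝ≥0∞} (hc : c ≠ 0)
    (h : ∀ δ : ℝ≥0, 0 < δ → ∀ᶠ k in atTop, ∀ (I : Finset ℕ) (y : ℕ → M) (ρ : ℕ → ℝ≥0),
      (∀ i ∈ I, δ ≤ ρ i) → S k ⊆ ⋃ i ∈ I, closedEBall (y i) (ρ i) →
      c ≤ ∑ i ∈ I, (ρ i : ℝ≥0∞) ^ (β : ℝ)) :
    (β : ℝ≥0∞) ≤ dimH E := by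
  rcases eq_or_ne β 0 with rfl | hβ
  · simp
  borelize M
  have : Nonempty M := ⟨hE'.some⟩
  suffices hle : c ≤ μH[β] E from
    le_dimH_of_hausdorffMeasure_ne_zero (ne_bot_of_le_ne_bot hc hle)
  rw [Measure.hausdorffMeasure_apply]
  -- One mesh size suffices for a lower bound; mesh 1 serves only to keep the diameters finite.
  refine le_iSup₂_of_le 1 one_pos (le_iInf₂ fun t ht => le_iInf fun htd => ?_)
  refine ENNReal.le_of_forall_pos_le_add fun ε hε _ => ?_
  obtain ⟨ε', hε', hsum⟩ := ENNReal.exists_pos_sum_of_countable (by exact_mod_cast hε.ne' :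
    (ε : ℝ≥0∞) ≠ 0) ℕ
  have hdt : ∀ i, ediam (t i) ≠ ⊤ := fun i => ((htd i).trans_lt ENNReal.one_lt_top).ne
  choose ρ hρ hρ' using fun i =>
    NNReal.exists_gt_rpow_lt_add (ediam (t i)).toNNReal (β := β) (hε' i)
  have hy : ∀ i, ∃ y : M, (t i).Nonempty → y ∈ t i := fun i => by
    by_cases hi : (t i).Nonempty
    · exact ⟨hi.some, fun _ => hi.some_mem⟩
    · exact ⟨hE'.some, fun h => absurd h hi⟩
  choose y hy using hy
  have hdρ : ∀ i, ediam (t i) < ρ i := fun i => by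
    rw [← ENNReal.coe_toNNReal (hdt i)]
    exact_mod_cast hρ i
  obtain ⟨b, hb, hbfin, hbE⟩ := hE.elim_finite_subcover_image (b := {i | (t i).Nonempty})
    (c := fun i => eball (y i) (ρ i)) (fun i _ => isOpen_eball) (by
      intro z hz
      obtain ⟨i, hi⟩ := mem_iUnion.1 (ht hz)
      exact mem_iUnion₂.2 ⟨i, ⟨z, hi⟩,
        (edist_le_ediam_of_mem hi (hy i ⟨z, hi⟩)).trans_lt (hdρ i)⟩)
  obtain ⟨I, rfl⟩ := hbfin.exists_finset_coe
  -- After compactness only finitely many balls remain, so their radii have a positive lower bound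
  -- and the hypothesis `h` applies.
  obtain ⟨δ, hδ, hδI⟩ : ∃ δ : ℝ≥0, 0 < δ ∧ ∀ i ∈ I, δ ≤ ρ i := by
    have h1 : ∀ᶠ δ in 𝓝[>] (0 : ℝ≥0), ∀ i ∈ I, δ ≤ ρ i :=
      (Finset.eventually_all I).2 fun i _ =>
        nhdsWithin_le_nhds (eventually_le_nhds (lt_of_le_of_lt zero_le (hρ i)))
    exact (eventually_mem_nhdsWithin.and h1).exists
  have hopen : IsOpen (⋃ i ∈ (I : Set ℕ), eball (y i) (ρ i)) :=
    isOpen_biUnion fun i _ => isOpen_eball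
  -- The open cover of `E` contains a neighbourhood of `E`, hence also `S k` for large `k`.
  obtain ⟨η, hη, hηU⟩ := hE.exists_thickening_subset_open hopen hbE
  obtain ⟨k, hk, hkη⟩ := ((h δ hδ).and
    (hS.eventually_lt_const (ENNReal.ofReal_pos.2 hη))).exists
  have hcov : S k ⊆ ⋃ i ∈ I, closedEBall (y i) (ρ i) := by
    intro z hz
    have hz' : z ∈ thickening η E := by
      rw [thickening, mem_ofPred_eq]
      rw [hausdorffEDist_comm] at hkη
      exact (infEDist_le_hausdorffEDist_of_mem hz).trans_lt hkη
    obtain ⟨i, hi, hzi⟩ := mem_iUnion₂.1 (hηU hz')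
    exact mem_iUnion₂.2 ⟨i, hi, eball_subset_closedEBall hzi⟩
  calc c ≤ ∑ i ∈ I, (ρ i : ℝ≥0∞) ^ (β : ℝ) := hk I y ρ hδI hcov
    _ ≤ ∑ i ∈ I, ((⨆ _ : (t i).Nonempty, ediam (t i) ^ (β : ℝ)) + ε' i) := by
      refine Finset.sum_le_sum fun i hi => ?_
      have hi' : (t i).Nonempty := hb hi
      rw [iSup_pos hi', ← ENNReal.coe_toNNReal (hdt i),
        ← ENNReal.coe_rpow_of_nonneg _ (NNReal.coe_nonneg β), ← ENNReal.coe_rpow_of_nonneg _ (NNReal.coe_nonneg β)]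
      exact_mod_cast (hρ' i).le
    _ ≤ ∑' i, ((⨆ _ : (t i).Nonempty, ediam (t i) ^ (β : ℝ)) + ε' i) := ENNReal.sum_le_tsum I
    _ = (∑' i, ⨆ _ : (t i).Nonempty, ediam (t i) ^ (β : ℝ)) + ∑' i, (ε' i : ℝ≥0∞) :=
      ENNReal.tsum_add
    _ ≤ _ := by gcongr

open Metric MeasureTheory in
theorem dimH_le_of_externalCoveringNumber_le {M : Type*} [EMetricSpace M] {E : Set M} {s K : ℝ≥0}
    (h : ∀ᶠ r in 𝓝[>] (0 : ℝ≥0),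
      ((externalCoveringNumber r E : ℕ∞) : ℝ≥0∞) * (r : ℝ≥0∞) ^ (s : ℝ) ≤ K) :
    dimH E ≤ s := by
  borelize M
  refine dimH_le_of_hausdorffMeasure_ne_top ?_
  choose C hC hcard using fun r : ℝ≥0 => exists_isCover_encard_eq r E
  have hfin : ∀ᶠ r in 𝓝[>] (0 : ℝ≥0), (C r).Finite := by
    filter_upwards [h, eventually_mem_nhdsWithin] with r hr hr0
    have hr0' : (0 : ℝ≥0∞) < r := by exact_mod_cast hr0
    rw [← hcard] at hr
    by_contra hinf
    rw [Set.Infinite.encard_eq hinf, ENat.toENNReal_top, ENNReal.top_mul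
      (ENNReal.rpow_pos hr0' ENNReal.coe_ne_top).ne'] at hr
    exact absurd hr (by simp)
  -- Infinite covers are replaced by the empty set so that every index type is finite; for small `r`
  -- nothing changes.
  let D : ℝ≥0 → Set M := fun r => open Classical in if (C r).Finite then C r else ∅
  have hDfin : ∀ r, (D r).Finite := fun r => by
    by_cases hr : (C r).Finite <;> simp [D, hr]
  have hD : ∀ᶠ r in 𝓝[>] (0 : ℝ≥0), D r = C r := hfin.mono fun r hr => by simp [D, hr]
  have : ∀ r, Fintype (D r) := fun r => (hDfin r).fintype
  have key := Measure.hausdorffMeasure_le_liminf_sum (X := M) (s : ℝ) E (l := 𝓝[>] (0 : ℝ≥0))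
    (ι := fun r => D r) (fun r => 2 * (r : ℝ≥0∞)) (by
      have : Tendsto (fun r : ℝ≥0 => ((2 * r : ℝ≥0) : ℝ≥0∞)) (𝓝 0) (𝓝 ((2 * 0 : ℝ≥0) : ℝ≥0∞)) :=
        ENNReal.tendsto_coe.2 (tendsto_id.const_mul 2)
      simpa using this.mono_left nhdsWithin_le_nhds)
    (fun r y => closedEBall (y : M) r)
    (Eventually.of_forall fun r y => ediam_closedEBall_le)
    (hD.mono fun r hr => by
      have := isCover_iff_subset_iUnion_closedEBall.1 (hC r)
      rw [← hr] at this
      rwa [iUnion_subtype])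
  have hbound : ∀ᶠ r in 𝓝[>] (0 : ℝ≥0),
      ∑ y : D r, ediam (closedEBall (y : M) r) ^ (s : ℝ) ≤ 2 ^ (s : ℝ) * (K : ℝ≥0∞) := by
    filter_upwards [h, hD] with r hr hDr
    calc ∑ y : D r, ediam (closedEBall (y : M) r) ^ (s : ℝ)
        ≤ ∑ y : D r, (2 * (r : ℝ≥0∞)) ^ (s : ℝ) := by
          gcongr; exact ediam_closedEBall_le
      _ = 2 ^ (s : ℝ) * (((externalCoveringNumber r E : ℕ∞) : ℝ≥0∞) * (r : ℝ≥0∞) ^ (s : ℝ)) := by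
          rw [Finset.sum_const, nsmul_eq_mul, ← hcard, ← hDr, encard_eq_coe_toFinset_card,
            ENNReal.mul_rpow_of_nonneg _ _ (NNReal.coe_nonneg s)]
          rw [Finset.card_univ, ← toFinset_card]
          simp only [ENat.toENNReal_coe]
          ring
      _ ≤ _ := by gcongr
  refine ne_top_of_le_ne_top ?_ (key.trans (liminf_le_of_frequently_le' hbound.frequently))
  finiteness

/-! ### Assouad dimension as an upper bound. -/

/-- The condition defining the Assouad dimension, for an exponent `s` and a constant `C`. -/
def AssouadBound {M : Type*} [PseudoEMetricSpace M] (F : Set M) (s C : ℝ≥0) : Prop :=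
  ∀ R r : ℝ≥0, 0 < r → r < R → ∀ x ∈ F,
    ((Metric.externalCoveringNumber r (Metric.closedEBall x (R : ℝ≥0∞) ∩ F) : ℕ∞) : ℝ≥0∞) ≤
      ((C * (R / r) ^ (s : ℝ) : ℝ≥0) : ℝ≥0∞)

theorem AssouadBound.mul_rpow_le {M : Type*} [PseudoEMetricSpace M] {F : Set M} {s C : ℝ≥0}
    (h : AssouadBound F s C) {x : M} (hx : x ∈ F) {R r : ℝ≥0} (hr : 0 < r) (hrR : r < R) :
    ((Metric.externalCoveringNumber r (Metric.closedEBall x (R : ℝ≥0∞) ∩ F) : ℕ∞) : ℝ≥0∞) *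
      (r : ℝ≥0∞) ^ (s : ℝ) ≤ ((C * R ^ (s : ℝ) : ℝ≥0) : ℝ≥0∞) := by
  have hpos : r ^ (s : ℝ) ≠ 0 := by positivity
  calc _ ≤ ((C * (R / r) ^ (s : ℝ) : ℝ≥0) : ℝ≥0∞) * (r : ℝ≥0∞) ^ (s : ℝ) := by
        gcongr; exact h R r hr hrR x hx
    _ = ((C * (R / r) ^ (s : ℝ) * r ^ (s : ℝ) : ℝ≥0) : ℝ≥0∞) := by
        rw [← ENNReal.coe_rpow_of_nonneg _ (NNReal.coe_nonneg s), ENNReal.coe_mul (_ * _)]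
    _ = _ := by
        rw [NNReal.div_rpow, mul_assoc, div_mul_cancel₀ _ hpos]

-- A similarity scales `R` and `r` alike, so the Assouad bound for `F` passes to T k (F) ∩ X with a
-- constant independent of `k`. Passing to the limit only doubles the radius.
open Metric in
theorem IsWeakTangent.dimH_le_assouadDim {M : Type*} [MetricSpace M] {X E F : Set M}
    (hX : Bornology.IsBounded X) (h : IsWeakTangent X E F) : dimH E ≤ assouadDim F := by
  obtain ⟨-, hE, -, T, hT⟩ := h
  refine le_iInf₂ fun s hs => ?_
  obtain ⟨C, hC0, hC⟩ := hs
  clear hC0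
  obtain ⟨D, hD0, hD⟩ : ∃ D : ℝ≥0, 0 < D ∧ ∀ x ∈ X, ∀ y ∈ X, edist x y ≤ D := by
    refine ⟨(ediam X).toNNReal + 1, by positivity, fun x hx y hy => ?_⟩
    refine (edist_le_ediam_of_mem hx hy).trans ?_
    rw [ENNReal.coe_add, ENNReal.coe_toNNReal hX.ediam_ne_top]
    exact le_self_add
  suffices hcov : ∀ r : ℝ≥0, 0 < r → r < D →
      ((externalCoveringNumber (2 * r) E : ℕ∞) : ℝ≥0∞) * (r : ℝ≥0∞) ^ (s : ℝ) ≤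
        ((C * D ^ (s : ℝ) : ℝ≥0) : ℝ≥0∞) by
    refine dimH_le_of_externalCoveringNumber_le (K := 2 ^ (s : ℝ) * (C * D ^ (s : ℝ))) ?_
    filter_upwards [eventually_mem_nhdsWithin, nhdsWithin_le_nhds (eventually_lt_nhds hD0)]
      with r hr0 hrD
    have hr0' : 0 < r := hr0
    have h1 := hcov (r / 2) (by positivity) ((NNReal.half_le_self r).trans_lt hrD)
    rw [mul_div_cancel₀ _ two_ne_zero] at h1
    calc ((externalCoveringNumber r E : ℕ∞) : ℝ≥0∞) * (r : ℝ≥0∞) ^ (s : ℝ)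
        = 2 ^ (s : ℝ) * (((externalCoveringNumber r E : ℕ∞) : ℝ≥0∞) *
            ((r / 2 : ℝ≥0) : ℝ≥0∞) ^ (s : ℝ)) := by
          rw [mul_left_comm, ← ENNReal.mul_rpow_of_nonneg _ _ (NNReal.coe_nonneg s),
            ← ENNReal.coe_ofNat, ← ENNReal.coe_mul, mul_div_cancel₀ _ two_ne_zero]
      _ ≤ 2 ^ (s : ℝ) * ((C * D ^ (s : ℝ) : ℝ≥0) : ℝ≥0∞) := by gcongr
      _ = _ := by
          rw [ENNReal.coe_mul (2 ^ (s : ℝ)), ENNReal.coe_rpow_of_nonneg _ (NNReal.coe_nonneg s)]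
          rfl
  intro r hr hrD
  obtain ⟨k, hk⟩ := (hT.eventually_lt_const (ENNReal.coe_pos.2 hr)).exists
  obtain ⟨z, ⟨x, hxF, rfl⟩, hxX⟩ := nonempty_of_hausdorffEDist_ne_top hE (hk.trans_le le_top).ne
  set c := Dilation.ratio (T k) with hc
  have hc0 : c ≠ 0 := Dilation.ratio_ne_zero _
  have hcpos : 0 < c := pos_iff_ne_zero.2 hc0
  have hsub : (T k '' F) ∩ X ⊆ T k '' (closedEBall x (D / c : ℝ≥0) ∩ F) := by
    rintro _ ⟨⟨y, hyF, rfl⟩, hyX⟩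
    refine ⟨y, ⟨?_, hyF⟩, rfl⟩
    have h1 := hD _ hyX _ hxX
    rw [Dilation.edist_eq, ← hc] at h1
    rw [mem_closedEBall, ENNReal.coe_div hc0]
    rwa [ENNReal.le_div_iff_mul_le (Or.inl (by exact_mod_cast hc0)) (Or.inl ENNReal.coe_ne_top),
      mul_comm]
  have h1 : externalCoveringNumber r ((T k '' F) ∩ X) ≤
      externalCoveringNumber (r / c) (closedEBall x (D / c : ℝ≥0) ∩ F) := by
    have := externalCoveringNumber_image_le (Dilation.lipschitz (T k)) (r / c)
      (closedEBall x (D / c : ℝ≥0) ∩ F)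
    rw [← hc, mul_div_cancel₀ _ hc0] at this
    exact (externalCoveringNumber_mono_set hsub).trans this
  have h2 : externalCoveringNumber (2 * r) E ≤ externalCoveringNumber r ((T k '' F) ∩ X) := by
    obtain ⟨N, hN, hcard⟩ := exists_isCover_encard_eq r ((T k '' F) ∩ X)
    rw [← hcard]
    refine IsCover.externalCoveringNumber_le_encard fun e he => ?_
    obtain ⟨w, hw, hew⟩ := exists_edist_lt_of_hausdorffEDist_lt he hk
    obtain ⟨y, hy, hwy⟩ := hN hw
    refine ⟨y, hy, (edist_triangle e w y).trans ?_⟩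
    rw [two_mul, ENNReal.coe_add]
    exact add_le_add hew.le hwy
  have h3 := hC (D / c) (r / c) (by positivity) (by gcongr) x hxF
  rw [div_div_div_cancel_right₀ hc0] at h3
  have hpos : r ^ (s : ℝ) ≠ 0 := by positivity
  calc ((externalCoveringNumber (2 * r) E : ℕ∞) : ℝ≥0∞) * (r : ℝ≥0∞) ^ (s : ℝ)
      ≤ ((C * (D / r) ^ (s : ℝ) : ℝ≥0) : ℝ≥0∞) * (r : ℝ≥0∞) ^ (s : ℝ) := by
        gcongr
        exact le_trans (by exact_mod_cast h2.trans h1) h3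
    _ = ((C * (D / r) ^ (s : ℝ) * r ^ (s : ℝ) : ℝ≥0) : ℝ≥0∞) := by
        rw [← ENNReal.coe_rpow_of_nonneg _ (NNReal.coe_nonneg s), ENNReal.coe_mul (_ * _)]
    _ = _ := by
        rw [NNReal.div_rpow, mul_assoc, div_mul_cancel₀ _ hpos]

open Metric in
theorem upperBoxDim_le_of_externalCoveringNumber_le {M : Type*} [PseudoEMetricSpace M] {F : Set M}
    {s K : ℝ≥0} (h : ∀ᶠ r in 𝓝[>] (0 : ℝ≥0),
      ((externalCoveringNumber r F : ℕ∞) : ℝ≥0∞) * (r : ℝ≥0∞) ^ (s : ℝ) ≤ K) :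
    upperBoxDim F ≤ ((s : ℝ) : EReal) := by
  refine EReal.le_of_forall_lt_iff_le.1 fun t ht => ?_
  have hst : (s : ℝ) < t := by exact_mod_cast ht
  refine limsup_le_of_le (h := ?_)
  have hsmall : ∀ᶠ r in 𝓝[>] (0 : ℝ≥0), K * r ^ (t - s) ≤ 1 := by
    have h1 := (NNReal.continuous_rpow_const (sub_pos.2 hst).le).tendsto 0
    rw [NNReal.zero_rpow (sub_pos.2 hst).ne'] at h1
    have h2 := h1.const_mul K
    rw [mul_zero] at h2
    exact nhdsWithin_le_nhds (h2.eventually_le_const one_pos)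
  filter_upwards [h, hsmall, eventually_mem_nhdsWithin,
    nhdsWithin_le_nhds (eventually_lt_nhds one_pos)] with r hr hK hr0 hr1
  have hr0' : 0 < r := hr0
  have hr1' : (r : ℝ) < 1 := by exact_mod_cast hr1
  have hr0'' : (0 : ℝ) < r := by exact_mod_cast hr0'
  have hlog : 0 < -Real.log r := neg_pos.2 (Real.log_neg hr0'' hr1')
  have hN : ((externalCoveringNumber r F : ℕ∞) : ℝ≥0∞) ≤ ((r ^ (-t) : ℝ≥0) : ℝ≥0∞) := by
    have hrs : (r : ℝ≥0∞) ^ (s : ℝ) = ((r ^ (s : ℝ) : ℝ≥0) : ℝ≥0∞) :=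
      (ENNReal.coe_rpow_of_nonneg _ (NNReal.coe_nonneg s)).symm
    have hpos : 0 < r ^ (s : ℝ) := by positivity
    rw [hrs, ← ENNReal.le_div_iff_mul_le (Or.inl (by exact_mod_cast hpos.ne'))
      (Or.inl ENNReal.coe_ne_top), ← ENNReal.coe_div hpos.ne'] at hr
    refine hr.trans (ENNReal.coe_le_coe.2 ?_)
    rw [div_le_iff₀ hpos, ← NNReal.rpow_add hr0'.ne']
    have hmul : K * r ^ (t - s) * r ^ (-t + s) ≤ 1 * r ^ (-t + s) := by gcongr
    rwa [mul_assoc, ← NNReal.rpow_add hr0'.ne', one_mul, show t - s + (-t + s) = 0 by ring,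
      NNReal.rpow_zero, mul_one] at hmul
  rw [EReal.div_le_iff_le_mul (by exact_mod_cast hlog) (EReal.coe_ne_top _)]
  refine (ENNReal.log_le_log hN).trans ?_
  rw [ENNReal.log_of_nnreal (by positivity), NNReal.coe_rpow, Real.log_rpow hr0'', ← EReal.coe_mul]
  exact_mod_cast (by linarith : -t * Real.log r ≤ -Real.log r * t)

/-- A bounded set lies in one ball of fixed radius `D`, and the Assouad bound with R = D controls
all its covering numbers at small scales. -/
theorem upperBoxDim_le_assouadDim {M : Type*} [PseudoMetricSpace M] {F : Set M}
    (hF : Bornology.IsBounded F) (hne : F.Nonempty) :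
    upperBoxDim F ≤ (assouadDim F : EReal) := by
  by_contra! hlt
  have h0 : 0 ≤ upperBoxDim F := (EReal.coe_ennreal_nonneg _).trans hlt.le
  rw [← EReal.coe_toENNReal h0, EReal.coe_ennreal_lt_coe_ennreal_iff, assouadDim] at hlt
  obtain ⟨s, hs⟩ := iInf_lt_iff.1 hlt
  obtain ⟨hsC, hs⟩ := iInf_lt_iff.1 hs
  obtain ⟨C, hC0, hC⟩ := hsC
  change AssouadBound F s C at hC
  obtain ⟨x, hx⟩ := hne
  set D : ℝ≥0 := (Metric.ediam F).toNNReal + 1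
  have hsub : Metric.closedEBall x D ∩ F = F := inter_eq_right.2 fun y hy => by
    refine (Metric.edist_le_ediam_of_mem hy hx).trans ?_
    rw [ENNReal.coe_add, ENNReal.coe_toNNReal hF.ediam_ne_top]
    exact le_self_add
  have hbox : upperBoxDim F ≤ ((s : ℝ) : EReal) := by
    refine upperBoxDim_le_of_externalCoveringNumber_le (K := C * D ^ (s : ℝ)) ?_
    filter_upwards [eventually_mem_nhdsWithin,
      nhdsWithin_le_nhds (eventually_lt_nhds (show (0 : ℝ≥0) < D by positivity))] with r hr0 hrD
    have := hC.mul_rpow_le hx hr0 hrD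
    rwa [hsub] at this
  rw [← EReal.coe_ennreal_lt_coe_ennreal_iff, EReal.coe_toENNReal h0] at hs
  exact absurd hbox hs.not_ge

/-! ### Existence of a tangent of full dimension. -/

-- Blaschke selection: the non-empty compact subsets of a compact space form a compact space.
open Metric TopologicalSpace in
theorem exists_subseq_tendsto_hausdorffEDist {M : Type*} [MetricSpace M] {X : Set M}
    (hX : IsCompact X) {S : ℕ → Set M} (hS : ∀ k, IsCompact (S k)) (hne : ∀ k, (S k).Nonempty)
    (hSX : ∀ k, S k ⊆ X) :
    ∃ (E : Set M) (φ : ℕ → ℕ), E ⊆ X ∧ IsCompact E ∧ E.Nonempty ∧ StrictMono φ ∧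
      Tendsto (fun k => hausdorffEDist E (S (φ k))) atTop (𝓝 0) := by
  have : CompactSpace X := isCompact_iff_compactSpace.1 hX
  have himg : ∀ k, (Subtype.val '' (Subtype.val ⁻¹' S k : Set X)) = S k := fun k => by
    rw [Subtype.image_preimage_coe, inter_eq_right.2 (hSX k)]
  let K : ℕ → NonemptyCompacts X := fun k =>
    ⟨⟨Subtype.val ⁻¹' S k, by rw [Subtype.isCompact_iff, himg]; exact hS k⟩, by
      obtain ⟨x, hx⟩ := hne k
      exact ⟨⟨x, hSX k hx⟩, hx⟩⟩
  obtain ⟨L, φ, hφ, hL⟩ := CompactSpace.tendsto_subseq K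
  refine ⟨Subtype.val '' (L : Set X), φ, by simp, L.isCompact.image continuous_subtype_val,
    L.nonempty.image _, hφ, ?_⟩
  rw [tendsto_iff_edist_tendsto_0] at hL
  refine hL.congr fun k => ?_
  rw [edist_comm]
  change hausdorffEDist (L : Set X) (Subtype.val ⁻¹' S (φ k)) = _
  rw [← hausdorffEDist_image isometry_subtype_coe, himg]

open Metric in
/-- Every non-empty compact set in a proper normed space has a weak tangent whose Hausdorff
dimension is the Assouad dimension of the set. -/
theorem exists_isWeakTangent_dimH_eq_assouadDim {V : Type*} [NormedAddCommGroup V]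
    [NormedSpace ℝ V] [ProperSpace V] {F X : Set V} (hF : IsCompact F) (hF' : F.Nonempty)
    (hX : IsCompact X) (hX' : (interior X).Nonempty) :
    ∃ E, IsWeakTangent X E F ∧ dimH E = assouadDim F := by
  obtain ⟨z, hz⟩ := hX'
  obtain ⟨ρ₀, hρ₀, hzX⟩ : ∃ ρ₀ : ℝ≥0, 0 < ρ₀ ∧ closedEBall z ρ₀ ⊆ X := by
    obtain ⟨ε, hε, h⟩ := Metric.nhds_basis_closedEBall.mem_iff.1 (mem_interior_iff_mem_nhds.1 hz)
    rcases eq_or_ne ε ⊤ with rfl | hε'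
    · exact ⟨1, one_pos, (closedEBall_subset_closedEBall le_top).trans h⟩
    · exact ⟨ε.toNNReal, ENNReal.toNNReal_pos hε.ne' hε', by rwa [ENNReal.coe_toNNReal hε']⟩
  choose x R r q hR hq hcard hhom using fun k => exists_closedEBall_homogeneous hF' k
  have hT : ∀ k, ∃ T : V ≃ᵈ V, T (x k) = z ∧
      ∀ u v, edist (T u) (T v) = ((ρ₀ / R k : ℝ≥0) : ℝ≥0∞) * edist u v := by
    intro k
    have hc : ((ρ₀ / R k : ℝ≥0) : ℝ) ≠ 0 := by
      have := hR k
      exact_mod_cast (by positivity : ρ₀ / R k ≠ 0)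
    -- This similarity carries the ball of radius `R k` about `x k` onto the ball of radius `ρ₀`
    -- about `z`, inside `X`.
    let T := (IsometryEquiv.subRight (x k)).toDilationEquiv.trans (DilationEquiv.smulTorsor z hc)
    have hTu : ∀ u, T u = ((ρ₀ / R k : ℝ≥0) : ℝ) • (u - x k) + z := fun u => rfl
    refine ⟨T, by simp [hTu], fun u v => ?_⟩
    rw [hTu, hTu, edist_add_right, edist_smul₀, edist_sub_right, NNReal.nnnorm_eq]
    rfl
  choose T hTx hT using hT
  have hsub : ∀ k, T k '' (closedEBall (x k) (R k) ∩ F) ⊆ (T k '' F) ∩ X := by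
    rintro k _ ⟨u, ⟨hu, huF⟩, rfl⟩
    refine ⟨⟨u, huF, rfl⟩, hzX ?_⟩
    rw [mem_closedEBall, ← hTx k, hT]
    calc _ ≤ ((ρ₀ / R k : ℝ≥0) : ℝ≥0∞) * R k := by gcongr; exact hu
      _ = ρ₀ := by rw [← ENNReal.coe_mul, div_mul_cancel₀ _ (hR k).ne']
  obtain ⟨E, φ, -, hEc, hEne, hφ, hE⟩ := exists_subseq_tendsto_hausdorffEDist hX
    (S := fun k => (T k '' F) ∩ X)
    (fun k => (hF.image (Dilation.lipschitz (T k)).continuous).inter hX)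
    (fun k => by
      have : (closedEBall (x k) (R k) ∩ F).Nonempty := by
        rw [← externalCoveringNumber_pos_iff (ε := r k), hcard k]
        exact_mod_cast hq k
      exact (this.image (T k)).mono (hsub k))
    (fun k => inter_subset_right)
  have htan : IsWeakTangent X E F := ⟨hEc, hEne, hF, fun k => T (φ k), hE⟩
  refine ⟨E, htan, (htan.dimH_le_assouadDim hX.isBounded).antisymm ?_⟩
  obtain ⟨p, hp⟩ := exists_isMaxCount F
  rw [← ENNReal.coe_toNNReal hp.assouadDim_ne_top]
  set β := (assouadDim F).toNNReal with hβ
  have hβ' : (assouadDim F).toReal = β := rfl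
  simp_rw [hβ'] at hhom
  -- A ball of radius `ρ i` in the blow-up has relative radius ρ i / ρ₀, so homogeneity gives it a
  -- share of at most 2(2 ρ i/ρ₀)^β = κ (ρ i)^β.
  set κ : ℝ≥0 := 2 * (2 / ρ₀) ^ (β : ℝ) with hκ
  have hκ0 : κ ≠ 0 := by positivity
  refine le_dimH_of_tendsto_hausdorffEDist hEc hEne hE (c := (κ : ℝ≥0∞)⁻¹) (by simp) fun δ hδ => ?_
  -- From here on, balls of radius at least `δ` fall within the range of scales where homogeneity is
  -- known.
  have hlarge : ∀ᶠ k in atTop, ((1 : ℝ≥0) / 2) ^ φ k ≤ δ / ρ₀ :=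
    hφ.tendsto_atTop.eventually <|
      (NNReal.tendsto_pow_atTop_nhds_zero_of_lt_one
        (NNReal.half_lt_self one_ne_zero)).eventually_le_const (by positivity)
  filter_upwards [hlarge] with k hk I y ρ hρ hcov
  generalize φ k = k at hk hcov
  have hcov' : closedEBall (x k) (R k) ∩ F ⊆ ⋃ i ∈ I,
      (closedEBall ((T k).symm (y i)) ((ρ i / ρ₀ * R k : ℝ≥0)) ∩ (closedEBall (x k) (R k) ∩ F)) := by
    intro u hu
    obtain ⟨i, hi, hui⟩ := mem_iUnion₂.1 (hcov (hsub k ⟨u, hu, rfl⟩))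
    refine mem_iUnion₂.2 ⟨i, hi, ?_, hu⟩
    have h1 := hT k u ((T k).symm (y i))
    rw [DilationEquiv.apply_symm_apply] at h1
    rw [mem_closedEBall, h1] at hui
    have h2 : edist u ((T k).symm (y i)) =
        ((R k / ρ₀ : ℝ≥0) : ℝ≥0∞) * (((ρ₀ / R k : ℝ≥0) : ℝ≥0∞) * edist u ((T k).symm (y i))) := by
      have := (hR k).ne'
      rw [← mul_assoc, ← ENNReal.coe_mul, show R k / ρ₀ * (ρ₀ / R k) = 1 by field_simp]
      simp
    rw [mem_closedEBall, h2]
    calc _ ≤ ((R k / ρ₀ : ℝ≥0) : ℝ≥0∞) * ρ i := by gcongr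
      _ = _ := by rw [← ENNReal.coe_mul]; congr 1; ring
  have hsum := externalCoveringNumber_le_sum (r k) I _ hcov'
  rw [hcard k] at hsum
  have hqpos : (q k : ℝ≥0∞) ≠ 0 := by exact_mod_cast (hq k).ne'
  have hmain : (q k : ℝ≥0∞) ≤ (κ * ∑ i ∈ I, (ρ i : ℝ≥0∞) ^ (β : ℝ)) * q k := by
    calc (q k : ℝ≥0∞) = (((q k : ℕ) : ℕ∞) : ℝ≥0∞) := by simp
      _ ≤ ∑ i ∈ I, ((externalCoveringNumber (r k) (closedEBall ((T k).symm (y i))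
            ((ρ i / ρ₀ * R k : ℝ≥0)) ∩ (closedEBall (x k) (R k) ∩ F)) : ℕ∞) : ℝ≥0∞) := by
          have := ENat.toENNReal_mono hsum
          rwa [← ENat.toENNRealRingHom_apply, map_sum] at this
      _ ≤ ∑ i ∈ I, ((2 * (2 * (ρ i / ρ₀)) ^ (β : ℝ) : ℝ≥0) : ℝ≥0∞) * q k := by
          refine Finset.sum_le_sum fun i hi => hhom k _ _ (hk.trans ?_)
          have := hρ i hi
          gcongr
      _ = _ := by
          rw [← Finset.sum_mul, Finset.mul_sum]
          congr 1
          refine Finset.sum_congr rfl fun i _ => ?_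
          rw [← ENNReal.coe_rpow_of_nonneg _ (NNReal.coe_nonneg β), ← ENNReal.coe_mul, hκ,
            mul_assoc, ← NNReal.mul_rpow]
          congr 3
          ring
  have h1 : 1 ≤ κ * ∑ i ∈ I, (ρ i : ℝ≥0∞) ^ (β : ℝ) := by
    rw [← ENNReal.mul_le_mul_iff_left hqpos (by simp), one_mul]
    exact hmain
  rw [ENNReal.inv_le_iff_le_mul]
  · exact h1
  all_goals simp [hκ0]

/-! ### The tent map and the Takagi function. -/

theorem tent_eq_abs_sub_round (x : ℝ) : tent x = |x - round x| := by
  rw [abs_sub_round_eq_min, tent]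
  split_ifs with h
  · rw [min_eq_left (by linarith)]
  · rw [min_eq_right (by linarith)]

theorem tent_nonneg (x : ℝ) : 0 ≤ tent x := by
  rw [tent_eq_abs_sub_round]; positivity

theorem tent_le_half (x : ℝ) : tent x ≤ 1 / 2 := by
  rw [tent_eq_abs_sub_round]; exact abs_sub_round x

theorem abs_tent_sub_tent_le (x y : ℝ) : |tent x - tent y| ≤ |x - y| := by
  have key : ∀ u v : ℝ, tent u ≤ |u - v| + tent v := fun u v => by
    rw [tent_eq_abs_sub_round, tent_eq_abs_sub_round v]
    exact (round_le u (round v)).trans (abs_sub_le _ _ _)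
  rw [abs_sub_le_iff]
  constructor
  · linarith [key x y]
  · linarith [key y x, abs_sub_comm x y]

/-- The Lipschitz bound serves for distances up to 1, the bounded oscillation beyond. -/
theorem abs_tent_sub_tent_le_rpow {α : ℝ} (hα : 0 ≤ α) (hα' : α ≤ 1) (x y : ℝ) :
    |tent x - tent y| ≤ |x - y| ^ α := by
  rcases le_total |x - y| 1 with h | h
  · exact (abs_tent_sub_tent_le x y).trans
      (by simpa using Real.rpow_le_rpow_of_exponent_ge' (abs_nonneg _) h hα hα')
  · refine le_trans ?_ (Real.one_le_rpow h hα)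
    rw [abs_sub_le_iff]
    constructor <;> linarith [tent_nonneg x, tent_nonneg y, tent_le_half x, tent_le_half y]

theorem continuous_tent : Continuous tent :=
  (LipschitzWith.of_dist_le_mul (K := 1) fun x y => by
    simpa [Real.dist_eq] using abs_tent_sub_tent_le x y).continuous

theorem tent_add_int (x : ℝ) (n : ℤ) : tent (x + n) = tent x := by
  simp [tent]

theorem tent_eq_sub {x : ℝ} (n : ℤ) (h : (n : ℝ) ≤ x) (h' : x ≤ n + 1 / 2) : tent x = x - n := by
  have : Int.fract x = x - n := Int.fract_eq_iff.2 ⟨by linarith, by linarith, n, by ring⟩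
  rw [tent, this, if_pos (by linarith)]

theorem tent_eq_add_one_sub {x : ℝ} (n : ℤ) (h : n + 1 / 2 ≤ x) (h' : x ≤ n + 1) :
    tent x = n + 1 - x := by
  rcases h'.eq_or_lt with rfl | hlt
  · rw [tent_eq_sub (n + 1) (by push_cast; rfl) (by push_cast; linarith)]
    push_cast; ring
  have : Int.fract x = x - n := Int.fract_eq_iff.2 ⟨by linarith, by linarith, n, by ring⟩
  rw [tent, this]
  split_ifs with h2 <;> linarith

section Takagi

variable {a : ℝ}

theorem abs_takagi_term_le (ha : 0 ≤ a) (b : ℝ) (x : ℝ) (n : ℕ) :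
    ‖a ^ n * tent (b ^ n * x)‖ ≤ a ^ n := by
  rw [norm_mul, norm_pow, Real.norm_of_nonneg ha, Real.norm_of_nonneg (tent_nonneg _)]
  exact mul_le_of_le_one_right (by positivity) ((tent_le_half _).trans (by norm_num))

theorem summable_takagi (ha : 0 ≤ a) (ha' : a < 1) (b : ℝ) (x : ℝ) :
    Summable fun n : ℕ => a ^ n * tent (b ^ n * x) :=
  Summable.of_norm_bounded (summable_geometric_of_lt_one ha ha') (abs_takagi_term_le ha b x)

theorem continuous_takagi (ha : 0 ≤ a) (ha' : a < 1) (b : ℝ) : Continuous (takagi a b) :=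
  continuous_tsum (fun n => continuous_const.mul (continuous_tent.comp (by fun_prop)))
    (summable_geometric_of_lt_one ha ha') (fun n x => abs_takagi_term_le ha b x n)

theorem takagi_eq_tent_add (ha : 0 ≤ a) (ha' : a < 1) (b : ℝ) (x : ℝ) :
    takagi a b x = tent x + a * takagi a b (b * x) := by
  rw [takagi, (summable_takagi ha ha' b x).tsum_eq_zero_add, takagi, ← tsum_mul_left]
  simp only [pow_zero, one_mul]
  congr 1
  refine tsum_congr fun n => ?_
  rw [pow_succ' a, pow_succ b, mul_assoc, mul_assoc (b ^ n)]

theorem takagi_natCast_add (a : ℝ) (b m : ℕ) (x : ℝ) : takagi a b (m + x) = takagi a b x := by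
  refine tsum_congr fun n => ?_
  have := tent_add_int ((b : ℝ) ^ n * x) (b ^ n * m : ℕ)
  push_cast at this
  rw [← this]
  congr 2
  ring

theorem tent_le_takagi (ha : 0 ≤ a) (ha' : a < 1) (b : ℝ) (x : ℝ) : tent x ≤ takagi a b x := by
  rw [takagi_eq_tent_add ha ha']
  have : 0 ≤ takagi a b (b * x) :=
    tsum_nonneg fun n => mul_nonneg (by positivity) (tent_nonneg _)
  nlinarith

theorem takagi_zero (a b : ℝ) : takagi a b 0 = 0 := by
  simp [takagi, tent]

/-- The n-th term contributes at most (a b^α)^n |x - y|^α, a convergent geometric series. -/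
theorem abs_takagi_sub_takagi_le (ha : 0 ≤ a) (ha' : a < 1) {b α : ℝ} (hb : 0 ≤ b) (hα : 0 ≤ α)
    (hα' : α ≤ 1) (hab : a * b ^ α < 1) (x y : ℝ) :
    |takagi a b x - takagi a b y| ≤ (1 - a * b ^ α)⁻¹ * |x - y| ^ α := by
  have hgeom := hasSum_geometric_of_lt_one (mul_nonneg ha (Real.rpow_nonneg hb α)) hab
  have hsum := hgeom.mul_right (|x - y| ^ α)
  rw [takagi, takagi, ← (summable_takagi ha ha' b x).tsum_sub (summable_takagi ha ha' b y)]
  rw [← Real.norm_eq_abs]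
  refine tsum_of_norm_bounded hsum fun n => ?_
  rw [← mul_sub, norm_mul, norm_pow, Real.norm_of_nonneg ha, mul_pow, mul_assoc]
  refine mul_le_mul_of_nonneg_left ?_ (by positivity)
  refine (abs_tent_sub_tent_le_rpow hα hα' _ _).trans_eq ?_
  rw [← mul_sub, abs_mul, abs_of_nonneg (by positivity), Real.mul_rpow (by positivity) (abs_nonneg _),
    ← Real.rpow_natCast_mul hb, mul_comm (n : ℝ), Real.rpow_mul_natCast hb]

end Takagi

/-! ### Graphs and the box dimension of Hölder graphs. -/

theorem dist_le_abs_add_abs (p q : EuclideanSpace ℝ (Fin 2)) :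
    dist p q ≤ |p 0 - q 0| + |p 1 - q 1| := by
  rw [EuclideanSpace.dist_eq, Fin.sum_univ_two, Real.dist_eq, Real.dist_eq]
  refine Real.sqrt_le_iff.2 ⟨by positivity, ?_⟩
  nlinarith [abs_nonneg (p 0 - q 0), abs_nonneg (p 1 - q 1)]

theorem abs_sub_le_dist (p q : EuclideanSpace ℝ (Fin 2)) (i : Fin 2) : |p i - q i| ≤ dist p q := by
  simpa [Real.dist_eq, dist_eq_norm] using PiLp.norm_apply_le (p - q) i

theorem graphOnUnit_eq_image (f : ℝ → ℝ) : graphOnUnit f = (fun t => !₂[t, f t]) '' Icc 0 1 := by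
  ext p
  constructor
  · rintro ⟨h, h'⟩
    refine ⟨p 0, h, ?_⟩
    ext i
    fin_cases i <;> simp [h']
  · rintro ⟨t, ht, rfl⟩
    exact ⟨by simpa using ht, by simp⟩

theorem isCompact_graphOnUnit {f : ℝ → ℝ} (hf : Continuous f) : IsCompact (graphOnUnit f) := by
  rw [graphOnUnit_eq_image]
  exact isCompact_Icc.image (by fun_prop)

theorem graphOnUnit_nonempty (f : ℝ → ℝ) : (graphOnUnit f).Nonempty := by
  rw [graphOnUnit_eq_image]
  exact (nonempty_Icc.2 zero_le_one).image _

-- About 1/r columns of width r suffice, and over each the graph oscillates by O(r^(2-s)), so it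
-- meets O(r^(1-s)) boxes of side r.
open Metric in
theorem upperBoxDim_graphOnUnit_le_of_holder {f : ℝ → ℝ} {C : ℝ} {s : ℝ≥0} (hs : 1 ≤ s)
    (hs' : s ≤ 2) (hC : 0 ≤ C) (hf : ∀ x y, |f x - f y| ≤ C * |x - y| ^ (2 - s : ℝ)) :
    upperBoxDim (graphOnUnit f) ≤ ((s : ℝ) : EReal) := by
  have hs1 : (1 : ℝ) ≤ s := by exact_mod_cast hs
  have hs2 : (s : ℝ) ≤ 2 := by exact_mod_cast hs'
  have hcov : ∀ r : ℝ≥0, 0 < r → r < 1 →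
      ∃ v : ℕ, externalCoveringNumber (2 * r) (graphOnUnit f) ≤ v ∧
        (v : ℝ) ≤ 2 * (2 * C + 5) / r ^ (s : ℝ) := by
    intro r hr hr1
    have hr0 : (0 : ℝ) < r := by exact_mod_cast hr
    have hr1' : (r : ℝ) < 1 := by exact_mod_cast hr1
    set m := ⌊(1 / r : ℝ)⌋₊ with hm
    -- `J` bounds the oscillation over one column in units of `r`. The centres form a grid of mesh
    -- `r`, and the radius `2 * r` allows an error below `r` in each coordinate.
    set J := ⌊C * r ^ (1 - s : ℝ)⌋₊ + 1 with hJ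
    let Z : Finset (EuclideanSpace ℝ (Fin 2)) :=
      ((Finset.range (m + 1)) ×ˢ (Finset.Icc (-(J : ℤ)) J)).image
        fun ij => !₂[(ij.1 : ℝ) * r, f (ij.1 * r) + ij.2 * r]
    refine ⟨Z.card, ?_, ?_⟩
    · have hZ : IsCover (2 * r) (graphOnUnit f) (Z : Set _) := by
        rintro p ⟨⟨hp0, hp1⟩, hp⟩
        set i := ⌊p 0 / r⌋₊ with hi
        have hi1 : (i : ℝ) * r ≤ p 0 := by
          rw [← le_div_iff₀ hr0]; exact Nat.floor_le (by positivity)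
        have hi2 : p 0 < i * r + r := by
          have := Nat.lt_floor_add_one (p 0 / r)
          rw [div_lt_iff₀ hr0] at this
          linarith
        have him : i ≤ m := Nat.floor_le_floor (by gcongr)
        set d := (f (p 0) - f (i * r)) / r with hd
        set l := ⌊d⌋ with hl
        have hl1 : (l : ℝ) * r ≤ f (p 0) - f (i * r) := by
          rw [← le_div_iff₀ hr0]; exact Int.floor_le _
        have hl2 : f (p 0) - f (i * r) < l * r + r := by
          have := Int.lt_floor_add_one d
          rw [div_lt_iff₀ hr0] at this
          linarith
        have hdJ : |d| < J := by
          have h1 : |f (p 0) - f (i * r)| ≤ C * (r : ℝ) ^ (2 - s : ℝ) :=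
            (hf _ _).trans (by
              gcongr
              rw [abs_of_nonneg (by linarith)]; linarith)
          have h2 : (r : ℝ) ^ (2 - s : ℝ) = r ^ (1 - s : ℝ) * r := by
            rw [show (2 - s : ℝ) = (1 - s) + 1 by ring, Real.rpow_add_one hr0.ne']
          rw [h2] at h1
          rw [hd, abs_div, abs_of_pos hr0, div_lt_iff₀ hr0]
          refine h1.trans_lt ?_
          rw [← mul_assoc]
          gcongr
          rw [hJ]
          push_cast
          exact Nat.lt_floor_add_one _
        rw [abs_lt] at hdJ
        have hlJ : -(J : ℤ) ≤ l ∧ l ≤ J :=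
          ⟨Int.le_floor.2 (by push_cast; linarith),
            by
              have : l < J := Int.floor_lt.2 (by exact_mod_cast hdJ.2)
              omega⟩
        refine ⟨!₂[(i : ℝ) * r, f (i * r) + l * r], ?_, ?_⟩
        · simp only [Z, Finset.coe_image, Set.mem_image, Finset.mem_coe, Finset.mem_product,
            Finset.mem_range, Finset.mem_Icc]
          exact ⟨(i, l), ⟨by omega, hlJ⟩, rfl⟩
        · change edist _ _ ≤ _
          rw [edist_dist]
          refine ENNReal.ofReal_le_of_le_toReal ?_
          refine (dist_le_abs_add_abs _ _).trans ?_
          simp only [Matrix.cons_val_zero, Matrix.cons_val_one]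
          rw [hp, abs_of_nonneg (by linarith), abs_of_nonneg (by linarith)]
          rw [ENNReal.coe_toReal]
          push_cast
          linarith
      simpa using hZ.externalCoveringNumber_le_encard
    · have hcard : Z.card ≤ (m + 1) * (2 * J + 1) := by
        refine Finset.card_image_le.trans ?_
        rw [Finset.card_product, Finset.card_range, Int.card_Icc]
        gcongr
        omega
      have hm' : (m : ℝ) + 1 ≤ 2 / r := by
        have h1 : (m : ℝ) ≤ 1 / r := Nat.floor_le (by positivity)
        have h2 : (1 : ℝ) ≤ 1 / r := (one_le_div hr0).2 hr1'.le
        calc (m : ℝ) + 1 ≤ 1 / r + 1 / r := by linarith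
          _ = 2 / r := by ring
      have hJ' : 2 * (J : ℝ) + 1 ≤ (2 * C + 5) * r ^ (1 - s : ℝ) := by
        have h1 : ((⌊C * r ^ (1 - s : ℝ)⌋₊ : ℕ) : ℝ) ≤ C * r ^ (1 - s : ℝ) :=
          Nat.floor_le (by positivity)
        have h2 : (1 : ℝ) ≤ r ^ (1 - s : ℝ) :=
          Real.one_le_rpow_of_pos_of_le_one_of_nonpos hr0 hr1'.le (by linarith)
        rw [hJ]
        push_cast
        nlinarith
      calc (Z.card : ℝ) ≤ ((m + 1) * (2 * J + 1) : ℕ) := by exact_mod_cast hcard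
        _ = ((m : ℝ) + 1) * (2 * J + 1) := by push_cast; ring
        _ ≤ 2 / r * ((2 * C + 5) * r ^ (1 - s : ℝ)) := by gcongr
        _ = _ := by
          rw [Real.rpow_sub hr0, Real.rpow_one]
          field_simp
  refine upperBoxDim_le_of_externalCoveringNumber_le
    (K := (2 * (2 * C + 5) * 2 ^ (s : ℝ)).toNNReal) ?_
  filter_upwards [eventually_mem_nhdsWithin, nhdsWithin_le_nhds (eventually_lt_nhds one_pos)]
    with r hr0 hr1
  have hr0' : 0 < r := hr0
  have hr0'' : (0 : ℝ) < r := by exact_mod_cast hr0'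
  obtain ⟨v, hv, hv'⟩ := hcov (r / 2) (by positivity) ((NNReal.half_le_self r).trans_lt hr1)
  rw [mul_div_cancel₀ _ two_ne_zero] at hv
  push_cast at hv'
  rw [Real.div_rpow hr0''.le two_pos.le, div_div_eq_mul_div, le_div_iff₀ (by positivity)] at hv'
  calc _ ≤ (((v : ℕ) : ℕ∞) : ℝ≥0∞) * (r : ℝ≥0∞) ^ (s : ℝ) := by gcongr
    _ = ((v * r ^ (s : ℝ) : ℝ≥0) : ℝ≥0∞) := by
      rw [ENNReal.coe_mul, ENNReal.coe_rpow_of_nonneg _ (NNReal.coe_nonneg s)]; rfl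
    _ ≤ _ := by
      rw [ENNReal.coe_le_coe]
      refine NNReal.le_toNNReal_of_coe_le ?_
      push_cast
      exact hv'

/-! ### The golden ratio example: Assouad dimension at least 4/3. -/

open Real in
/-- On each of eight intervals of length `1 / 512` the function `T_{φ/8,8}` is a copy of itself,
scaled by `(φ / 8) ^ 3` and shifted by the same constant. -/
theorem takagi_goldenRatio_div_eight {w : ℕ} (hw : w ∈ ({4, 5, 6, 7, 504, 505, 506, 507} : Finset ℕ))
    {t : ℝ} (ht : t ∈ Icc (0 : ℝ) 1) :
    takagi (goldenRatio / 8) (8 : ℕ) ((w + t) / 512) =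
      (goldenRatio / 8) ^ 2 + (goldenRatio / 8) ^ 3 * takagi (goldenRatio / 8) (8 : ℕ) t := by
  have ha : 0 ≤ goldenRatio / 8 := by positivity
  have ha' : goldenRatio / 8 < 1 := by linarith [goldenRatio_lt_two]
  have hsq := goldenRatio_sq
  set g := goldenRatio with hg
  obtain ⟨ht0, ht1⟩ := ht
  have hper := takagi_natCast_add (g / 8) 8 w t
  have e3 : ((8 : ℕ) : ℝ) * ((8 : ℕ) * ((8 : ℕ) * ((w + t) / 512))) = w + t := by
    push_cast; ring
  rw [takagi_eq_tent_add ha ha', takagi_eq_tent_add ha ha' _ ((8 : ℕ) * ((w + t) / 512)),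
    takagi_eq_tent_add ha ha' _ ((8 : ℕ) * ((8 : ℕ) * ((w + t) / 512))), e3, hper]
  generalize takagi (g / 8) (8 : ℕ) t = v
  have hcase : (4 ≤ w ∧ w ≤ 7) ∨ (504 ≤ w ∧ w ≤ 507) := by
    simp only [Finset.mem_insert, Finset.mem_singleton] at hw
    omega
  push_cast
  -- In base 8 the admissible words are 00d with d = 4, ..., 7 and 77d with d = 0, ..., 3. The first
  -- three terms have slopes 1, g, -g² on the former and -1, -g, g² on the latter; both sums vanish,
  -- and the constant left is a² in both cases.
  rcases hcase with ⟨h1, h2⟩ | ⟨h1, h2⟩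
  · have h1' : (4 : ℝ) ≤ w := by exact_mod_cast h1
    have h2' : (w : ℝ) ≤ 7 := by exact_mod_cast h2
    rw [tent_eq_sub 0 (by push_cast; linarith) (by push_cast; linarith),
      tent_eq_sub (x := 8 * ((w + t) / 512)) 0 (by push_cast; linarith) (by push_cast; linarith),
      tent_eq_add_one_sub (x := 8 * (8 * ((w + t) / 512))) 0 (by push_cast; linarith)
        (by push_cast; linarith)]
    push_cast
    linear_combination (-(w + t) / 512) * hsq
  · have h1' : (504 : ℝ) ≤ w := by exact_mod_cast h1
    have h2' : (w : ℝ) ≤ 507 := by exact_mod_cast h2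
    rw [tent_eq_add_one_sub 0 (by push_cast; linarith) (by push_cast; linarith),
      tent_eq_add_one_sub (x := 8 * ((w + t) / 512)) 7 (by push_cast; linarith)
        (by push_cast; linarith),
      tent_eq_sub (x := 8 * (8 * ((w + t) / 512))) 63 (by push_cast; linarith)
        (by push_cast; linarith)]
    push_cast
    linear_combination ((w + t) / 512 - 1) * hsq

-- Iterating the eight copies works because they share one additive constant: `c` does not depend on
-- `p`, so all 8^j copies sit at the same height.
open Real in
theorem exists_finset_takagi_affine_copies (j : ℕ) :
    ∃ (P : Finset ℕ) (c : ℝ), P.card = 8 ^ j ∧ (∀ p ∈ P, p < 512 ^ j) ∧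
      ∀ p ∈ P, ∀ t ∈ Icc (0 : ℝ) 1,
        takagi (goldenRatio / 8) (8 : ℕ) ((p + t) / 512 ^ j) =
          c + ((goldenRatio / 8) ^ 3) ^ j * takagi (goldenRatio / 8) (8 : ℕ) t := by
  induction j with
  | zero =>
    refine ⟨{0}, 0, by simp, by simp, fun p hp t _ => ?_⟩
    simp [Finset.mem_singleton.1 hp]
  | succ j ih =>
    obtain ⟨P, c, hcard, hlt, hP⟩ := ih
    set S : Finset ℕ := {4, 5, 6, 7, 504, 505, 506, 507} with hS
    have hinj : Set.InjOn (fun wp : ℕ × ℕ => wp.1 * 512 ^ j + wp.2) (S ×ˢ P : Finset (ℕ × ℕ)) := by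
      rintro ⟨w, p⟩ h ⟨w', p'⟩ h' heq
      simp only [Finset.coe_product, mem_prod, Finset.mem_coe] at h h' heq
      have hp := hlt p h.2
      have hp' := hlt p' h'.2
      have hw : w = w' := by
        have := congrArg (· / 512 ^ j) heq
        simpa [Nat.add_div_of_dvd_right (Dvd.intro_left w rfl),
          Nat.add_div_of_dvd_right (Dvd.intro_left w' rfl), Nat.div_eq_of_lt hp,
          Nat.div_eq_of_lt hp'] using this
      subst hw
      simpa using heq
    refine ⟨(S ×ˢ P).image fun wp => wp.1 * 512 ^ j + wp.2,
      (goldenRatio / 8) ^ 2 + (goldenRatio / 8) ^ 3 * c, ?_, ?_, ?_⟩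
    · rw [Finset.card_image_of_injOn hinj, Finset.card_product, hcard, pow_succ']
      rfl
    · intro q hq
      obtain ⟨⟨w, p⟩, hwp, rfl⟩ := Finset.mem_image.1 hq
      obtain ⟨hw, hp⟩ := Finset.mem_product.1 hwp
      have hw' : w ≤ 511 := by
        simp only [hS, Finset.mem_insert, Finset.mem_singleton] at hw
        omega
      have := hlt p hp
      have h2 : w * 512 ^ j ≤ 511 * 512 ^ j := Nat.mul_le_mul_right _ hw'
      simp only
      rw [pow_succ']
      omega
    · intro q hq t ht
      obtain ⟨⟨w, p⟩, hwp, rfl⟩ := Finset.mem_image.1 hq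
      obtain ⟨hw, hp⟩ := Finset.mem_product.1 hwp
      have hpt : (p + t) / 512 ^ j ∈ Icc (0 : ℝ) 1 := by
        have h1 : (p : ℝ) + 1 ≤ 512 ^ j := by exact_mod_cast hlt p hp
        refine ⟨div_nonneg (add_nonneg p.cast_nonneg ht.1) (by positivity), ?_⟩
        rw [div_le_one (by positivity)]
        linarith [ht.2]
      have hx : (((w * 512 ^ j + p : ℕ) : ℝ) + t) / 512 ^ (j + 1) =
          (w + (p + t) / 512 ^ j) / 512 := by
        push_cast
        field_simp
        ring
      rw [hx, takagi_goldenRatio_div_eight hw hpt, hP p hp t ht]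
      ring

-- At depth 5j a copy has width 512^(-5j) and vertical factor A^(5j), where A = (g/8)³. The
-- inequality says that it is stretched vertically by at least 512^j relative to its width; it
-- reduces to g^5 > 8.
open Real in
theorem one_le_goldenRatio_scaling (j : ℕ) :
    (1 : ℝ) ≤ ((goldenRatio / 8) ^ 3) ^ (4 * j + j) * 512 ^ (4 * j) := by
  have hsq := goldenRatio_sq
  have h5 : goldenRatio ^ 5 = 5 * goldenRatio + 3 := by
    linear_combination (goldenRatio ^ 3 + goldenRatio ^ 2 + 2 * goldenRatio + 3) * hsq
  have hg : (1 : ℝ) < goldenRatio := one_lt_goldenRatio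
  have h8 : (1 : ℝ) ≤ goldenRatio ^ 5 / 8 := by rw [h5]; linarith
  calc (1 : ℝ) ≤ ((goldenRatio ^ 5 / 8) ^ 3) ^ j := one_le_pow₀ (one_le_pow₀ h8)
    _ = (((goldenRatio / 8) ^ 3) ^ 5 * 512 ^ 4) ^ j := by congr 1; ring
    _ = _ := by rw [mul_pow, ← pow_mul, ← pow_mul, ← pow_mul, ← pow_mul]; ring_nf

open Real Metric in
/-- At some location the graph of `T_{φ/8,8}` is nearly a product of an interval with a set of
dimension `1 / 3`, down to the relative scale `512 ^ (-j)`. -/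
theorem exists_le_externalCoveringNumber_takagi (j : ℕ) :
    ∃ x ∈ graphOnUnit (takagi (goldenRatio / 8) (8 : ℕ)), ∃ r : ℝ≥0, 0 < r ∧
      ((4096 ^ j : ℕ) : ℕ∞) ≤ externalCoveringNumber r (closedEBall x (16 * 512 ^ j * r : ℝ≥0) ∩
        graphOnUnit (takagi (goldenRatio / 8) (8 : ℕ))) := by
  have ha : 0 < goldenRatio / 8 := by positivity
  have ha' : goldenRatio / 8 < 1 := by linarith [goldenRatio_lt_two]
  obtain ⟨P₀, c₀, hcard₀, hlt₀, hP₀⟩ := exists_finset_takagi_affine_copies (4 * j)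
  obtain ⟨P, c, hcard, hlt, hP⟩ := exists_finset_takagi_affine_copies j
  have hscale := one_le_goldenRatio_scaling j
  have hcont := continuous_takagi ha.le ha' ((8 : ℕ) : ℝ)
  have hhalf := tent_le_takagi ha.le ha' ((8 : ℕ) : ℝ) (1 / 2)
  rw [tent_eq_sub 0 (by norm_num) (by norm_num)] at hhalf
  have hzero := takagi_zero (goldenRatio / 8) ((8 : ℕ) : ℝ)
  set f := takagi (goldenRatio / 8) (8 : ℕ) with hf
  set A := (goldenRatio / 8) ^ 3 with hA
  have hApos : 0 < A := by positivity
  obtain ⟨p₀, hp₀⟩ : P₀.Nonempty := by rw [← Finset.card_pos, hcard₀]; positivity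
  obtain ⟨q₀, hq₀⟩ : P.Nonempty := by rw [← Finset.card_pos, hcard]; positivity
  set r : ℝ := 1 / 512 ^ (4 * j + j) with hr
  have hr0 : 0 < r := by positivity
  have hrA : r * 512 ^ j ≤ A ^ (4 * j + j) := by
    rw [hr, pow_add, one_div_mul_eq_div, div_le_iff₀ (by positivity)]
    have : (0 : ℝ) ≤ 512 ^ j := by positivity
    nlinarith
  -- Inside a copy, heights in steps of r/2 are reached by the intermediate value theorem, as f(0) =
  -- 0 and f(1/2) ≥ 1/2. Keeping `u` in the left half leaves horizontal gaps of at least r/2 between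
  -- different columns. Beyond the range of `i` the value 0 is a dummy.
  have hu : ∀ i : ℕ, ∃ u ∈ Icc (0 : ℝ) (1 / 2), i < 512 ^ j → A ^ (4 * j + j) * f u = i * (r / 2) := by
    intro i
    by_cases hi : i < 512 ^ j
    · have hi' : (i : ℝ) ≤ 512 ^ j := by exact_mod_cast hi.le
      have hmem : i * (r / 2) / A ^ (4 * j + j) ∈ Icc (f 0) (f (1 / 2)) := by
        rw [hzero]
        refine ⟨by positivity, le_trans ?_ hhalf⟩
        rw [div_le_iff₀ (by positivity)]
        push_cast
        nlinarith
      obtain ⟨u, hu, hfu⟩ := intermediate_value_Icc (by norm_num : (0 : ℝ) ≤ 1 / 2)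
        hcont.continuousOn hmem
      exact ⟨u, hu, fun _ => by rw [hfu, mul_div_cancel₀ _ (by positivity)]⟩
    · exact ⟨0, by norm_num, fun h => absurd h hi⟩
  choose u hu hfu using hu
  -- One interval of length 512^(-4j) holds 8^j columns of width `r`, each with 512^j points: 4096^j
  -- points in a region of size about 512^j r.
  let X : ℕ × ℕ → ℝ := fun qi => (p₀ + (qi.1 + u qi.2) / 512 ^ j) / 512 ^ (4 * j)
  have hunit : ∀ qi ∈ P ×ˢ Finset.range (512 ^ j), (qi.1 + u qi.2) / 512 ^ j ∈ Icc (0 : ℝ) 1 := by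
    rintro ⟨q, i⟩ h
    obtain ⟨hq, -⟩ := Finset.mem_product.1 h
    have h1 : (q : ℝ) + 1 ≤ 512 ^ j := by exact_mod_cast hlt q hq
    refine ⟨div_nonneg (add_nonneg q.cast_nonneg (hu i).1) (by positivity), ?_⟩
    rw [div_le_one (by positivity)]
    have := (hu i).2
    simp only
    linarith
  have hXf : ∀ qi ∈ P ×ˢ Finset.range (512 ^ j),
      f (X qi) = c₀ + A ^ (4 * j) * c + qi.2 * (r / 2) := by
    rintro ⟨q, i⟩ h
    obtain ⟨hq, hi⟩ := Finset.mem_product.1 h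
    have h1 := hunit _ h
    simp only [X]
    rw [hP₀ p₀ hp₀ _ h1, hP q hq (u i) ⟨(hu i).1, (hu i).2.trans (by norm_num)⟩,
      ← hfu i (by simpa using hi), pow_add]
    ring
  have hXr : ∀ qi, X qi = p₀ / 512 ^ (4 * j) + (qi.1 + u qi.2) * r := fun qi => by
    simp only [X, hr, pow_add]
    field_simp
  let Z : ℕ × ℕ → EuclideanSpace ℝ (Fin 2) := fun qi => !₂[X qi, f (X qi)]
  have hZ0 : ∀ qi, Z qi 0 = X qi := fun qi => by simp [Z]
  have hZ1 : ∀ qi, Z qi 1 = f (X qi) := fun qi => by simp [Z]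
  have hgraph : ∀ qi ∈ P ×ˢ Finset.range (512 ^ j), Z qi ∈ graphOnUnit f := by
    intro qi h
    have h1 := hunit _ h
    have h2 : (p₀ : ℝ) + 1 ≤ 512 ^ (4 * j) := by exact_mod_cast hlt₀ p₀ hp₀
    refine ⟨?_, by rw [hZ0, hZ1]⟩
    rw [hZ0]
    refine ⟨div_nonneg (add_nonneg p₀.cast_nonneg h1.1) (by positivity), ?_⟩
    rw [div_le_one (by positivity)]
    linarith [h1.2]
  have hsep : ∀ qi ∈ P ×ˢ Finset.range (512 ^ j), ∀ qi' ∈ P ×ˢ Finset.range (512 ^ j),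
      qi ≠ qi' → r / 2 ≤ dist (Z qi) (Z qi') := by
    rintro ⟨q, i⟩ h ⟨q', i'⟩ h' hne
    rcases eq_or_ne q q' with rfl | hq
    · have hi : i ≠ i' := fun hi => hne (by rw [hi])
      refine le_trans ?_ (abs_sub_le_dist _ _ 1)
      rw [hZ1, hZ1, hXf _ h, hXf _ h']
      have h1 : (1 : ℝ) ≤ |(i : ℝ) - i'| := by
        have : (1 : ℤ) ≤ |(i : ℤ) - i'| := Int.one_le_abs (by omega)
        exact_mod_cast this
      have h2 : c₀ + A ^ (4 * j) * c + i * (r / 2) - (c₀ + A ^ (4 * j) * c + i' * (r / 2)) =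
          ((i : ℝ) - i') * (r / 2) := by ring
      rw [h2, abs_mul, abs_of_pos (half_pos hr0)]
      nlinarith
    · refine le_trans ?_ (abs_sub_le_dist _ _ 0)
      rw [hZ0, hZ0, hXr, hXr]
      have h1 : (1 : ℝ) ≤ |(q : ℝ) - q'| := by
        have : (1 : ℤ) ≤ |(q : ℤ) - q'| := Int.one_le_abs (by omega)
        exact_mod_cast this
      have h2 : (p₀ : ℝ) / 512 ^ (4 * j) + (q + u i) * r - (p₀ / 512 ^ (4 * j) + (q' + u i') * r) =
          (((q : ℝ) - q') + (u i - u i')) * r := by ring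
      have h3 : |u i - u i'| ≤ 1 / 2 := by
        rw [abs_sub_le_iff]
        constructor <;> linarith [(hu i).1, (hu i).2, (hu i').1, (hu i').2]
      have h4 : 1 / 2 ≤ |((q : ℝ) - q') + (u i - u i')| := by
        have := abs_sub_abs_le_abs_sub ((q : ℝ) - q') (-(u i - u i'))
        rw [abs_neg, sub_neg_eq_add] at this
        linarith
      rw [h2, abs_mul, abs_of_pos hr0]
      nlinarith
  have hmem₀ : (q₀, 0) ∈ P ×ˢ Finset.range (512 ^ j) :=
    Finset.mem_product.2 ⟨hq₀, by simp⟩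
  have hr8 : 0 < r / 8 := by positivity
  -- With radius r/8 the packing bound needs separation greater than r/4, which r/2 exceeds; the
  -- ball of radius 16 · 512^j · r/8 = 2 · 512^j r contains all the points.
  obtain ⟨ε, hε⟩ : ∃ ε : ℝ≥0, (ε : ℝ) = r / 8 := CanLift.prf _ hr8.le
  refine ⟨Z (q₀, 0), hgraph _ hmem₀, ε, NNReal.coe_pos.1 (hε ▸ hr8), ?_⟩
  have hinj : Set.InjOn Z (P ×ˢ Finset.range (512 ^ j) : Finset (ℕ × ℕ)) := by
    intro qi h qi' h' heq
    by_contra hne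
    have := hsep qi h qi' h' hne
    rw [heq, dist_self] at this
    linarith
  have hdist : ∀ qi ∈ P ×ˢ Finset.range (512 ^ j), dist (Z qi) (Z (q₀, 0)) ≤ 2 * 512 ^ j * r := by
    intro qi h
    refine (dist_le_abs_add_abs _ _).trans ?_
    have h1 := hunit _ h
    have h2 := hunit _ hmem₀
    rw [hZ0, hZ0, hZ1, hZ1, hXf _ h, hXf _ hmem₀]
    have h3 : |X qi - X (q₀, 0)| ≤ 512 ^ j * r := by
      have : X qi - X (q₀, 0) =
          ((qi.1 + u qi.2) / 512 ^ j - (q₀ + u 0) / 512 ^ j) * (512 ^ j * r) := by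
        rw [hXr, hXr]
        field_simp
        ring
      rw [this, abs_mul, abs_of_pos (by positivity : 0 < 512 ^ j * r)]
      refine mul_le_of_le_one_left (by positivity) ?_
      rw [abs_sub_le_iff]
      simp only [mem_Icc] at h1 h2
      constructor <;> linarith [h1.1, h1.2, h2.1, h2.2]
    have h4 : (qi.2 : ℝ) ≤ 512 ^ j := by
      exact_mod_cast (Finset.mem_range.1 (Finset.mem_product.1 h).2).le
    have h5 : |c₀ + A ^ (4 * j) * c + qi.2 * (r / 2) -
        (c₀ + A ^ (4 * j) * c + ((0 : ℕ) : ℝ) * (r / 2))| = qi.2 * (r / 2) := by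
      rw [Nat.cast_zero, zero_mul, add_zero, add_sub_cancel_left, abs_of_nonneg (by positivity)]
    rw [h5]
    nlinarith
  refine le_trans ?_ (packingNumber_two_mul_le_externalCoveringNumber _ _)
  have hcardZ : (Z '' (P ×ˢ Finset.range (512 ^ j) : Finset (ℕ × ℕ))).encard = (4096 ^ j : ℕ) := by
    rw [hinj.encard_image, encard_coe_eq_coe_finsetCard, Finset.card_product, hcard,
      Finset.card_range, ← mul_pow]
    norm_num
  rw [← hcardZ]
  refine IsSeparated.encard_le_packingNumber ?_ ?_
  · rintro _ ⟨qi, h, rfl⟩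
    refine ⟨?_, hgraph qi h⟩
    rw [mem_closedEBall, edist_dist]
    refine ENNReal.ofReal_le_of_le_toReal ((hdist qi h).trans_eq ?_)
    rw [ENNReal.coe_toReal]
    push_cast
    rw [hε]
    ring
  · rintro _ ⟨qi, h, rfl⟩ _ ⟨qi', h', rfl⟩ hne
    have h1 := hsep qi h qi' h' (fun h => hne (by rw [h]))
    rw [edist_dist, ← ENNReal.ofReal_coe_nnreal]
    rw [ENNReal.ofReal_lt_ofReal_iff (by linarith)]
    push_cast
    rw [hε]
    linarith

-- Since 4096 = 512^(4/3), an exponent s < 4/3 would bound the powers of 4096/512^s > 1.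
open Real in
theorem four_thirds_le_assouadDim_takagi :
    ((4 / 3 : ℝ≥0) : ℝ≥0∞) ≤ assouadDim (graphOnUnit (takagi (goldenRatio / 8) (8 : ℕ))) := by
  refine le_iInf₂ fun s hs => ?_
  obtain ⟨C, -, hC⟩ := hs
  by_contra! hlt
  have hs43 : (s : ℝ) < 4 / 3 := by
    have : s < 4 / 3 := by exact_mod_cast hlt
    exact_mod_cast this
  have hbound : ∀ j : ℕ, (4096 / 512 ^ (s : ℝ) : ℝ) ^ j ≤ C * 16 ^ (s : ℝ) := by
    intro j
    obtain ⟨x, hx, r, hr, hle⟩ := exists_le_externalCoveringNumber_takagi j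
    have h1 : r < 16 * 512 ^ j * r := by
      refine lt_mul_of_one_lt_left hr (lt_of_lt_of_le (by norm_num : (1 : ℝ≥0) < 16) ?_)
      exact le_mul_of_one_le_right (by positivity) (one_le_pow₀ (by norm_num))
    have h2 := hC _ r hr h1 x hx
    rw [mul_div_cancel_right₀ _ hr.ne'] at h2
    have h3 : ((4096 ^ j : ℕ) : ℝ≥0) ≤ C * (16 * 512 ^ j) ^ (s : ℝ) := by
      rw [← ENNReal.coe_le_coe]
      refine le_trans ?_ h2
      have := ENat.toENNReal_mono hle
      simpa using this
    have h4 : (4096 : ℝ) ^ j ≤ C * (16 * 512 ^ j) ^ (s : ℝ) := by exact_mod_cast h3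
    rw [div_pow, div_le_iff₀ (by positivity)]
    rwa [Real.mul_rpow (by norm_num) (by positivity), ← Real.rpow_natCast_mul (by norm_num),
      mul_comm (j : ℝ), Real.rpow_mul_natCast (by norm_num), ← mul_assoc] at h4
  have hgt : (1 : ℝ) < 4096 / 512 ^ (s : ℝ) := by
    rw [one_lt_div (by positivity)]
    calc (512 : ℝ) ^ (s : ℝ) < 512 ^ (4 / 3 : ℝ) :=
          Real.rpow_lt_rpow_of_exponent_lt (by norm_num) hs43
      _ = 4096 := by
          rw [show (512 : ℝ) = 8 ^ (3 : ℝ) by norm_num, ← Real.rpow_mul (by norm_num)]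
          norm_num
  obtain ⟨j, hj⟩ := pow_unbounded_of_one_lt (C * 16 ^ (s : ℝ) : ℝ) hgt
  exact absurd (hbound j) hj.not_ge

/-! ### The golden ratio example: upper box dimension, and conclusion. -/

open Real in
theorem upperBoxDim_takagi_goldenRatio_le :
    upperBoxDim (graphOnUnit (takagi (goldenRatio / 8) (8 : ℕ))) ≤ (((5 / 4 : ℝ≥0) : ℝ) : EReal) := by
  have ha : 0 < goldenRatio / 8 := by positivity
  have ha' : goldenRatio / 8 < 1 := by linarith [goldenRatio_lt_two]
  -- The fourth power of the left side is g⁴/8, and g⁴ = 3g + 2 < 8; this makes 3/4 an admissible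
  -- Hölder exponent.
  have hlt : goldenRatio / 8 * ((8 : ℕ) : ℝ) ^ (3 / 4 : ℝ) < 1 := by
    have hsq := goldenRatio_sq
    have h4 : goldenRatio ^ 4 < 8 := by
      have : goldenRatio ^ 4 = 3 * goldenRatio + 2 := by
        linear_combination (goldenRatio ^ 2 + goldenRatio + 2) * hsq
      rw [this]
      linarith [goldenRatio_lt_two]
    refine lt_of_pow_lt_pow_left₀ 4 zero_le_one ?_
    rw [mul_pow, div_pow, ← Real.rpow_mul_natCast (by positivity)]
    norm_num
    linarith
  refine upperBoxDim_graphOnUnit_le_of_holder (C := (1 - goldenRatio / 8 * ((8 : ℕ) : ℝ) ^ (3 / 4 : ℝ))⁻¹)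
    (by rw [← NNReal.coe_le_coe]; push_cast; norm_num)
    (by rw [← NNReal.coe_le_coe]; push_cast; norm_num) (inv_nonneg.2 (by linarith)) fun x y => ?_
  have h := abs_takagi_sub_takagi_le ha.le ha' (b := (8 : ℕ)) (α := 3 / 4) (by norm_num)
    (by norm_num) (by norm_num) hlt x y
  convert h using 3
  push_cast
  norm_num

theorem IsLittlewoodTakagiParam.pos {a : ℝ} {b : ℕ} (h : IsLittlewoodTakagiParam a b) : 0 < a := by
  by_contra! ha
  have := mul_nonpos_of_nonpos_of_nonneg ha b.cast_nonneg
  linarith [h.2.2.1]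

open Real in
theorem isLittlewoodTakagiParam_goldenRatio : IsLittlewoodTakagiParam (goldenRatio / 8) 8 := by
  have h8 : goldenRatio / 8 * ((8 : ℕ) : ℝ) = goldenRatio := by push_cast; ring
  refine ⟨by linarith [goldenRatio_lt_two], by norm_num, by rw [h8]; exact one_lt_goldenRatio, ?_⟩
  rw [h8]
  refine ⟨3, fun n => if n = 2 then -1 else 1, by norm_num, fun n _ => ?_, ?_⟩
  · by_cases h : n = 2 <;> simp [h]
  · simp [Finset.sum_range_succ, goldenRatio_sq]
    ring

theorem lemma1p2 :
    (∀ (a : ℝ) (b : ℕ), IsLittlewoodTakagiParam a b →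
      (∀ X : Set (EuclideanSpace ℝ (Fin 2)), IsCompact X → (interior X).Nonempty →
        ∃ E : Set (EuclideanSpace ℝ (Fin 2)),
          IsWeakTangent X E (graphOnUnit (takagi a b)) ∧
          dimH E = assouadDim (graphOnUnit (takagi a b))) ∧
      upperBoxDim (graphOnUnit (takagi a b)) ≤
        (assouadDim (graphOnUnit (takagi a b)) : EReal)) ∧
    (∃ (a : ℝ) (b : ℕ), IsLittlewoodTakagiParam a b ∧ a * b = Real.goldenRatio ∧ b = 8 ∧
      upperBoxDim (graphOnUnit (takagi a b)) <
        (assouadDim (graphOnUnit (takagi a b)) : EReal)) := by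
  refine ⟨fun a b h => ?_, Real.goldenRatio / 8, 8, isLittlewoodTakagiParam_goldenRatio,
    by push_cast; ring, rfl, ?_⟩
  · have hcomp := isCompact_graphOnUnit (continuous_takagi h.pos.le h.1 b)
    have hne := graphOnUnit_nonempty (takagi a b)
    exact ⟨fun X hX hX' => exists_isWeakTangent_dimH_eq_assouadDim hcomp hne hX hX',
      upperBoxDim_le_assouadDim hcomp.isBounded hne⟩
  · refine upperBoxDim_takagi_goldenRatio_le.trans_lt (lt_of_lt_of_le ?_
      (EReal.coe_ennreal_le_coe_ennreal_iff.2 four_thirds_le_assouadDim_takagi))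
    change (((5 / 4 : ℝ≥0) : ℝ) : EReal) < (((4 / 3 : ℝ≥0) : ℝ) : EReal)
    rw [EReal.coe_lt_coe_iff]
    push_cast
    norm_num
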